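/- **Weighted isoperimetry and transportation-information inequality.** Let $(X_t)_{t\ge 0}$ be a birth-death process on $\mathbb N=\{0,1,2,\dots\}$ with birth rates $\lambda_x$ and death rates $\nu_x$, where $\lambda_x>0$ for $x\ge 0$, $\nu_0=0$, $\nu_x>0$ for $x\ge 1$, and assume that it is positive recurrent and non-explosive, i.e. $$\sum_{x\ge1}\frac{\lambda_0\cdots\lambda_{x-1}}{\nu_1\cdots\nu_x}<\infty,\qquad \sum_{x\ge1}\Big(\frac1{\lambda_x}+\frac{\nu_x}{\lambda_x\lambda_{x-1}}+\cdots+\frac{\nu_x\cdots\nu_1}{\lambda_x\cdots\lambda_0}\Big)=\infty .$$ Let $\mu$ be its stationary distribution, $\mu(x)=\mu(0)\prod_{y=1}^x\lambda_{y-1}/\nu_y$. Write $\partial f(x)=f(x+1)-f(x)$ and $\mathcal E_\mu(f,f)=\int\lambda\,(\partial f)^2\,d\mu$, with domain $\mathcal D(\mathcal E_\mu)=\{f\in L^2(\mu):\mathcal E_\mu(f,f)<\infty\}$. Let $u:\mathbb N\to(0,\infty)$ and let $d_u(x,y)=|\rho(x)-\rho(y)|$, where $\rho(x+1)-\rho(x)=u_x$.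 For probability measures on $\mathbb N$ let $\mathcal W_{d_u}\in[0,\infty]$ be the Wasserstein distance, i.e. the infimum of $\int d_u\,d\gamma$ over all couplings $\gamma$. Let $(X_{u,t})_{t\ge0}$ be the minimal birth-death process with birth rates $\lambda^u_x=\frac{u_{x+1}}{u_x}\lambda_{x+1}$ and death rates $\nu^u_x=\frac{u_{x-1}}{u_x}\nu_x$ (with $\nu^u_0=0$), and let $V_u(x)=\nu_{x+1}-\nu^u_x+\lambda_x-\lambda^u_x$. Assume that $$\kappa_u:=\int_0^\infty\sup_{x\in\mathbb N}\mathbb E_x\Big[\exp\Big(-\int_0^tV_u(X_{u,s})\,ds\Big)\Big]dt<\infty ,$$ where trajectories of $X_u$ that have exploded by time $t$, if any, do not contribute to the expectation. (1) One has $0<\kappa_u<\infty$, and for every probability measure $\pi=f\mu$ with $f\in\mathcal D(\mathcal E_\mu)$, $$\frac1{\kappa_u}\,\mathcal W_{d_u}(\pi,\mu)\le\int_{\mathbb N}\lambda\,u\,|\partial f|\,d\mu\in[0,\infty].$$ (2) Let $S$ be a non-empty set of pairs $(\varepsilon,\theta)$ with $\varepsilon>0$, $\theta>1$, and suppose that for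 every $(\varepsilon,\theta)\in S$ there are given constants $a=a_{\varepsilon,\theta}\ge0$ and $b=b_{\varepsilon,\theta}>0$ such that, for all $x\in\mathbb N$, $$(1+\varepsilon)\lambda_xu_x^2+(1+1/\varepsilon)\nu_xu_{x-1}^2\le-a\big(\lambda_x(\theta-1)+\nu_x(1/\theta-1)\big)+b$$ (the term containing $u_{x-1}$ being $0$ for $x=0$). Put $$\alpha(r):=\sup_{(\varepsilon,\theta)\in S}\frac{\sqrt{b^2+2a(r/\kappa_u)^2}-b}{2a},\qquad r\ge0,$$ where for $a=0$ the quotient is read as its limit $(r/\kappa_u)^2/(2b)$. Then this supremum is finite, $\alpha$ is continuous and strictly increasing on $[0,\infty)$, positive on $(0,\infty)$, and $\alpha(0)=0$; and for every probability measure $\pi=f\mu$, $$\alpha\big(\mathcal W_{d_u}(\pi,\mu)\big)\le\mathcal I(\pi,\mu),\qquad \mathcal I(\pi,\mu):=\begin{cases}\mathcal E_\mu(\sqrt f,\sqrt f)&\text{if }\sqrt f\in\mathcal D(\mathcal E_\mu),\\ \infty&\text{otherwise,}\end{cases}$$ with the convention $\alpha(\infty)=\infty$. -/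

import Mathlib

open MeasureTheory ProbabilityTheory

noncomputable section

namespace BirthDeath

/-- Birth rates `lam` and death rates `nu` of an irreducible, non-explosive and positive recurrent
birth-death process on `ℕ`. -/
structure IsErgodic (lam nu : ℕ → ℝ) : Prop where
  birth_pos : ∀ x, 0 < lam x
  death_zero : nu 0 = 0
  death_pos : ∀ x, 0 < nu (x + 1)
  /-- Positive recurrence: the sum over `x` of
  `(lam 0 * ... * lam (x - 1)) / (nu 1 * ... * nu x)` is finite. -/
  positive_recurrent : Summable fun x : ℕ => ∏ y ∈ Finset.range x, lam y / nu (y + 1)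
  /-- Non-explosion: the sum over `x` of
  `1 / lam x + nu x / (lam x * lam (x - 1)) + ...
    + (nu x * ... * nu 1) / (lam x * ... * lam 0)` is infinite. -/
  non_explosive : ¬ Summable fun x : ℕ =>
    ∑ k ∈ Finset.range (x + 1), (∏ j ∈ Finset.Ioc k x, nu j) / ∏ j ∈ Finset.Icc k x, lam j

/-- Mass of the point `x` under the stationary distribution. -/
def stationaryMass (lam nu : ℕ → ℝ) (x : ℕ) : ℝ :=
  (∑' z : ℕ, ∏ y ∈ Finset.range z, lam y / nu (y + 1))⁻¹ *
    ∏ y ∈ Finset.range x, lam y / nu (y + 1)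

/-- The stationary distribution of the process. -/
def stationary (lam nu : ℕ → ℝ) : Measure ℕ :=
  Measure.sum fun x => ENNReal.ofReal (stationaryMass lam nu x) • Measure.dirac x

/-! ### The minimal birth-death process with given rates -/

/-- Joint law of an exponential variable of mean `1` and an independent uniform variable on
`[0, 1]`. -/
def stepLaw : Measure (ℝ × ℝ) :=
  (expMeasure 1).prod (volume.restrict (Set.Icc (0 : ℝ) 1))

instance : IsProbabilityMeasure stepLaw := by
  have : IsProbabilityMeasure (expMeasure 1) := isProbabilityMeasure_expMeasure one_pos
  have : IsProbabilityMeasure (volume.restrict (Set.Icc (0 : ℝ) 1)) := ⟨by simp⟩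
  unfold stepLaw
  infer_instance

/-- Law of an independent sequence of such pairs; it drives the process. -/
def driving : Measure (ℕ → ℝ × ℝ) := Measure.infinitePi fun _ => stepLaw

/-- The embedded jump chain started at `x`: from `y` it moves to `y + 1` with probability
`lam y / (lam y + nu y)` and to `y - 1` otherwise. -/
def jumpChain (lam nu : ℕ → ℝ) (x : ℕ) (ω : ℕ → ℝ × ℝ) : ℕ → ℕ
  | 0 => x
  | n + 1 =>
    if (ω n).2 ≤ lam (jumpChain lam nu x ω n) /
        (lam (jumpChain lam nu x ω n) + nu (jumpChain lam nu x ω n))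
    then jumpChain lam nu x ω n + 1
    else jumpChain lam nu x ω n - 1

/-- Time of the `n`-th jump: the holding time in a state `y` is exponential with parameter
`lam y + nu y`. -/
def jumpTime (lam nu : ℕ → ℝ) (x : ℕ) (ω : ℕ → ℝ × ℝ) (n : ℕ) : ℝ :=
  ∑ k ∈ Finset.range n,
    (ω k).1 / (lam (jumpChain lam nu x ω k) + nu (jumpChain lam nu x ω k))

open Classical in
/-- Position at time `t` of the minimal process started at `x`: it is `some y` if the process sits
at `y`, and `none` from the explosion time (the limit of the jump times) on. -/
def position (lam nu : ℕ → ℝ) (x : ℕ) (ω : ℕ → ℝ × ℝ) (t : ℝ) : Option ℕ :=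
  if h : ∃ n, t < jumpTime lam nu x ω (n + 1)
  then some (jumpChain lam nu x ω (Nat.find h))
  else none

/-- The Feynman-Kac expectation `E_x[exp(- ∫_0^t V(X_s) ds)]` for the minimal process with rates
`lam` and `nu`; as usual, paths that have exploded by time `t` do not contribute. -/
def feynmanKac (lam nu V : ℕ → ℝ) (t : ℝ) (x : ℕ) : ENNReal :=
  ∫⁻ ω, (if (position lam nu x ω t).isSome
    then ENNReal.ofReal
      (Real.exp (-∫ s in (0 : ℝ)..t, (position lam nu x ω s).elim 0 V))
    else 0) ∂driving

/-! ### The `u`-modification -/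

/-- Birth rates of the `u`-modification. -/
def modBirth (lam u : ℕ → ℝ) (x : ℕ) : ℝ := u (x + 1) / u x * lam (x + 1)

/-- Death rates of the `u`-modification; the value at `0` is `0` because `nu 0 = 0`. -/
def modDeath (nu u : ℕ → ℝ) (x : ℕ) : ℝ := u (x - 1) / u x * nu x

/-- The potential `V_u`. -/
def potential (lam nu u : ℕ → ℝ) (x : ℕ) : ℝ :=
  nu (x + 1) - modDeath nu u x + lam x - modBirth lam u x

/-- The constant `κ_u`. -/
def kappa (lam nu u : ℕ → ℝ) : ENNReal :=
  ∫⁻ t in Set.Ioi (0 : ℝ),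
    ⨆ x : ℕ, feynmanKac (modBirth lam u) (modDeath nu u) (potential lam nu u) t x

/-! ### Distances, Dirichlet form, information -/

/-- The distance `d_u` on `ℕ` for which consecutive points `x` and `x + 1` are at distance
`u x`. -/
def weightDist (u : ℕ → ℝ) (x y : ℕ) : ℝ :=
  |∑ z ∈ Finset.range x, u z - ∑ z ∈ Finset.range y, u z|

/-- The Wasserstein distance of order one with cost `d`. -/
def wasserstein (d : ℕ → ℕ → ℝ) (m₁ m₂ : Measure ℕ) : ENNReal :=
  ⨅ γ ∈ {γ : Measure (ℕ × ℕ) | γ.map Prod.fst = m₁ ∧ γ.map Prod.snd = m₂},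
    ∫⁻ p, ENNReal.ofReal (d p.1 p.2) ∂γ

/-- The forward gradient. -/
def grad (f : ℕ → ℝ) (x : ℕ) : ℝ := f (x + 1) - f x

/-- The Dirichlet form on the diagonal, `∫ lam (∂f)² dμ`. -/
def energy (lam nu f : ℕ → ℝ) : ENNReal :=
  ∫⁻ x, ENNReal.ofReal (lam x * grad f x ^ 2) ∂stationary lam nu

/-- The domain of the Dirichlet form. -/
def InDomain (lam nu f : ℕ → ℝ) : Prop :=
  MemLp f 2 (stationary lam nu) ∧ energy lam nu f < ⊤

/-- `π` is a probability measure with density `f` with respect to the stationary distribution. -/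
def HasDensity (lam nu : ℕ → ℝ) (π : Measure ℕ) (f : ℕ → ℝ) : Prop :=
  IsProbabilityMeasure π ∧ (∀ x, 0 ≤ f x) ∧
    π = (stationary lam nu).withDensity fun x => ENNReal.ofReal (f x)

open Classical in
/-- The Fisher-Donsker-Varadhan information of the probability measure with density `f`. -/
def information (lam nu f : ℕ → ℝ) : ENNReal :=
  if InDomain lam nu (fun x => √(f x)) then energy lam nu (fun x => √(f x)) else ⊤

/-- The weighted isoperimetric inequality with weight `u` and constant `h`. -/
def WeightedIsoperimetric (lam nu u : ℕ → ℝ) (h : ℝ) : Prop :=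
  0 < h ∧ ∀ (π : Measure ℕ) (f : ℕ → ℝ), HasDensity lam nu π f → InDomain lam nu f →
    ENNReal.ofReal h * wasserstein (weightDist u) π (stationary lam nu) ≤
      ∫⁻ x, ENNReal.ofReal (lam x * u x * |grad f x|) ∂stationary lam nu

/-- Value of a deviation function at a point of `[0, ∞]`, with value `∞` at `∞`. -/
def extendTop (α : ℝ → ℝ) (w : ENNReal) : ENNReal :=
  if w = ⊤ then ⊤ else ENNReal.ofReal (α w.toReal)

/-- The transportation-information inequality for `d_u` with deviation function `α`. -/
def TransportationInformation (lam nu u : ℕ → ℝ) (α : ℝ → ℝ) : Prop :=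
  (ContinuousOn α (Set.Ici 0) ∧ StrictMonoOn α (Set.Ici 0) ∧ α 0 = 0 ∧ ∀ r, 0 < r → 0 < α r) ∧
  ∀ (π : Measure ℕ) (f : ℕ → ℝ), HasDensity lam nu π f →
    extendTop α (wasserstein (weightDist u) π (stationary lam nu)) ≤ information lam nu f

/-- The Lyapunov-type condition with parameters `ε`, `θ` and constants `a`, `b`. -/
def Lyapunov (lam nu u : ℕ → ℝ) (ε θ a b : ℝ) : Prop :=
  ∀ x : ℕ, (1 + ε) * lam x * u x ^ 2 + (1 + 1 / ε) * nu x * u (x - 1) ^ 2 ≤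
    -a * (lam x * (θ - 1) + nu x * (1 / θ - 1)) + b

/-- `(√(b² + 2 a s²) - b) / (2 a)`, read for `a = 0` as its limit `s² / (2 b)`. -/
def deviationTerm (a b s : ℝ) : ℝ :=
  if a = 0 then s ^ 2 / (2 * b) else (√(b ^ 2 + 2 * a * s ^ 2) - b) / (2 * a)

/-- The values over which the deviation function at `r` is the supremum, when `(ε, θ)` ranges over
`S` and `κ` is the isoperimetric parameter. -/
def deviationValues (κ : ℝ) (S : Set (ℝ × ℝ)) (a b : ℝ → ℝ → ℝ) (r : ℝ) : Set ℝ :=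
  (fun p : ℝ × ℝ => deviationTerm (a p.1 p.2) (b p.1 p.2) (r / κ)) '' S

end BirthDeath

end

/-! Write `ρ` for the partial sums of `u`, `m` for the stationary masses and `κ` for `kappa`. The
Feynman-Kac Green function `G` of the `u`-modified process is bounded by `κ` and satisfies `(lam x +
nu (x+1)) * G x = 1 + modBirth * G (x+1) + modDeath * G (x-1)`, because adding the potential to the
modified rates leaves `lam x + nu (x+1)`. Multiplied by `u`, this is the differenced Poisson
equation, so `u * G` is minus the gradient of a solution of the Poisson equation with right side `ρ
- c`. Summed against `m`, it yields `∑_{y ≤ z} m y * (c - ρ y) = lam z * m z * u z * G z ≤ κ * lam z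
* m z * u z` (`IsErgodic.exists_poisson`). Positivity of the left side forces `c ≥ ∫ ρ dμ`, so the
kernel `∑_{y ≤ z < y'} m y * m y' * (ρ y' - ρ y)` obeys the same bound (`IsErgodic.kernel_le`).

The quantile coupling bounds the Wasserstein distance by the `u`-weighted sum of the differences of
distribution functions. Each difference is a sum over pairs `y ≤ x < y'` of `m y * m y' * (f y - f
y')`. Expanding into gradients and exchanging sums makes the kernel appear, which proves (1), with
no need for `f` to lie in the domain.

For (2), put `g = √f`, so that `|∂f| = |∂g| (g x + g (x+1))`. Cauchy-Schwarz leaves `∫ lam u² (g x +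
g (x+1))² dμ`, which detailed balance and the Lyapunov condition bound by `a I + b`
(`Lyapunov.sum_le`), where `I` is the information. Hence `(W/κ)² ≤ I (a I + b)`, and `deviationTerm`
inverts the weaker `(W/κ)² ≤ 2aI² + 2bI`. -/

namespace BirthDeath

/-! ### First-step decomposition of the paths -/

section FirstStep

open Set

variable (lam nu V : ℕ → ℝ)

/-- The state entered at the first jump from `x`. -/
noncomputable def firstState (x : ℕ) (p : ℝ × ℝ) : ℕ :=
  if p.2 ≤ lam x / (lam x + nu x) then x + 1 else x - 1

/-- The time of the first jump from `x`. -/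
noncomputable def firstTime (x : ℕ) (p : ℝ × ℝ) : ℝ := p.1 / (lam x + nu x)

/-- The driving sequence without its first term. -/
def shift (ω : ℕ → ℝ × ℝ) : ℕ → ℝ × ℝ := fun n => ω (n + 1)

variable {lam nu V}

lemma jumpChain_succ_eq (x : ℕ) (ω : ℕ → ℝ × ℝ) (n : ℕ) :
    jumpChain lam nu x ω (n + 1) =
      jumpChain lam nu (firstState lam nu x (ω 0)) (shift ω) n := by
  induction n with
  | zero => rfl
  | succ n ih => rw [jumpChain, ih]; rfl

lemma jumpTime_one (x : ℕ) (ω : ℕ → ℝ × ℝ) :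
    jumpTime lam nu x ω 1 = firstTime lam nu x (ω 0) := by
  simp [jumpTime, firstTime, jumpChain]

lemma jumpTime_succ_eq (x : ℕ) (ω : ℕ → ℝ × ℝ) (n : ℕ) :
    jumpTime lam nu x ω (n + 1) = firstTime lam nu x (ω 0) +
      jumpTime lam nu (firstState lam nu x (ω 0)) (shift ω) n := by
  rw [jumpTime, Finset.sum_range_succ', add_comm]
  simp only [jumpChain_succ_eq]
  rfl

lemma position_of_lt {x : ℕ} {ω : ℕ → ℝ × ℝ} {t : ℝ} (ht : t < firstTime lam nu x (ω 0)) :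
    position lam nu x ω t = some x := by
  classical
  have h : ∃ n, t < jumpTime lam nu x ω (n + 1) := ⟨0, by rwa [zero_add, jumpTime_one]⟩
  have h0 : Nat.find h = 0 := by
    rw [Nat.find_eq_zero, zero_add, jumpTime_one]; exact ht
  rw [position, dif_pos h, h0]
  rfl

lemma position_of_le {x : ℕ} {ω : ℕ → ℝ × ℝ} {t : ℝ} (ht : firstTime lam nu x (ω 0) ≤ t) :
    position lam nu x ω t =
      position lam nu (firstState lam nu x (ω 0)) (shift ω) (t - firstTime lam nu x (ω 0)) := by
  classical
  have key (n : ℕ) : t < jumpTime lam nu x ω (n + 1 + 1) ↔ t - firstTime lam nu x (ω 0) <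
      jumpTime lam nu (firstState lam nu x (ω 0)) (shift ω) (n + 1) := by
    rw [jumpTime_succ_eq x ω (n + 1), sub_lt_iff_lt_add']
  have h0 : ¬ t < jumpTime lam nu x ω (0 + 1) := by
    rw [zero_add, jumpTime_one]; exact not_lt.2 ht
  by_cases h' : ∃ n, t - firstTime lam nu x (ω 0) <
      jumpTime lam nu (firstState lam nu x (ω 0)) (shift ω) (n + 1)
  · have h₂ : ∃ n, t < jumpTime lam nu x ω (n + 1 + 1) := h'.imp fun n hn => (key n).2 hn
    have h : ∃ n, t < jumpTime lam nu x ω (n + 1) := let ⟨n, hn⟩ := h₂; ⟨n + 1, hn⟩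
    -- The index `0` is excluded by `h0`, so the least index is one more than that of the shifted
    -- path.
    have hf : Nat.find h = Nat.find h' + 1 := by
      rw [Nat.find_comp_succ h h₂ h0]
      congr 1
      exact Nat.find_congr' (by intro n; exact key n)
    rw [position, position, dif_pos h, dif_pos h', hf, jumpChain_succ_eq]
  · have h : ¬ ∃ n, t < jumpTime lam nu x ω (n + 1) := by
      rintro ⟨n | n, hn⟩
      · exact h0 hn
      · exact h' ⟨n, (key n).1 hn⟩
    rw [position, position, dif_neg h, dif_neg h']

variable (lam nu V) in
/-- The Feynman-Kac weight of the path up to time `t`, restricted to the paths with fewer than `N`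
jumps before time `t`. -/
noncomputable def truncWeight : ℕ → ℕ → (ℕ → ℝ × ℝ) → ℝ → ENNReal
  | 0, _, _, _ => 0
  | N + 1, x, ω, t =>
    if t < firstTime lam nu x (ω 0) then ENNReal.ofReal (Real.exp (-(V x * t)))
    else ENNReal.ofReal (Real.exp (-(V x * firstTime lam nu x (ω 0)))) *
      truncWeight N (firstState lam nu x (ω 0)) (shift ω) (t - firstTime lam nu x (ω 0))

/-- Induction on the jump budget, splitting the path at its first jump. Interval integrability is
carried along because splitting the time integral of `V` there requires it. -/
lemma truncWeight_eq_zero_or (hq : ∀ x, 0 < lam x + nu x) (N : ℕ) {x : ℕ} {ω : ℕ → ℝ × ℝ}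
    (hω : ∀ k, 0 < (ω k).1) {t : ℝ} (ht : 0 ≤ t) :
    truncWeight lam nu V N x ω t = 0 ∨ ((position lam nu x ω t).isSome ∧
      IntervalIntegrable (fun s => (position lam nu x ω s).elim 0 V) volume 0 t ∧
      truncWeight lam nu V N x ω t =
        ENNReal.ofReal (Real.exp (-∫ s in (0 : ℝ)..t, (position lam nu x ω s).elim 0 V))) := by
  induction N generalizing x ω t with
  | zero => exact Or.inl rfl
  | succ N ih =>
    rw [truncWeight]
    set σ := firstTime lam nu x (ω 0) with hσ
    have hσ0 : 0 < σ := div_pos (hω 0) (hq x)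
    have hconst {r : ℝ} (hr0 : 0 ≤ r) (hr : r ≤ σ) :
        (fun s => (position lam nu x ω s).elim 0 V) =ᵐ[volume.restrict (uIoc 0 r)]
          fun _ => V x := by
      rw [uIoc_of_le hr0, ← restrict_Ioo_eq_restrict_Ioc]
      filter_upwards [self_mem_ae_restrict measurableSet_Ioo] with s hs
      rw [position_of_lt (hs.2.trans_le hr)]
      rfl
    have hint {r : ℝ} (hr0 : 0 ≤ r) (hr : r ≤ σ) :
        IntervalIntegrable (fun s => (position lam nu x ω s).elim 0 V) volume 0 r ∧
          ∫ s in (0 : ℝ)..r, (position lam nu x ω s).elim 0 V = V x * r := by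
      refine ⟨(intervalIntegrable_const (c := V x)).congr_ae (hconst hr0 hr).symm, ?_⟩
      rw [intervalIntegral.integral_congr_ae_restrict (hconst hr0 hr)]
      simp [mul_comm]
    split_ifs with h
    · right
      obtain ⟨h1, h2⟩ := hint ht h.le
      exact ⟨by rw [position_of_lt h]; rfl, h1, by rw [h2]⟩
    · rw [not_lt] at h
      rcases ih (x := firstState lam nu x (ω 0)) (ω := shift ω) (fun k => hω (k + 1))
        (sub_nonneg.2 h) with h0 | ⟨h1, h2, h3⟩
      · left; rw [h0, mul_zero]
      · right
        obtain ⟨i1, i2⟩ := hint hσ0.le le_rfl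
        have hcongr : EqOn (fun s => (position lam nu (firstState lam nu x (ω 0)) (shift ω)
            (s - σ)).elim 0 V) (fun s => (position lam nu x ω s).elim 0 V) (uIcc σ t) := by
          intro s hs
          rw [uIcc_of_le h] at hs
          simp only [position_of_le hs.1, hσ]
        have j1 : IntervalIntegrable (fun s => (position lam nu x ω s).elim 0 V) volume σ t := by
          have := h2.comp_sub_right σ
          rw [zero_add, sub_add_cancel] at this
          exact this.congr fun s hs => hcongr (uIoc_subset_uIcc hs)
        refine ⟨by rw [position_of_le h]; exact h1, i1.trans j1, ?_⟩
        rw [← intervalIntegral.integral_add_adjacent_intervals i1 j1, i2,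
          ← intervalIntegral.integral_congr hcongr,
          intervalIntegral.integral_comp_sub_right
            (fun s => (position lam nu (firstState lam nu x (ω 0)) (shift ω) s).elim 0 V) σ,
          sub_self, h3, ← ENNReal.ofReal_mul (Real.exp_pos _).le, ← Real.exp_add, neg_add]

lemma truncWeight_le (hq : ∀ x, 0 < lam x + nu x) (N : ℕ) {x : ℕ} {ω : ℕ → ℝ × ℝ}
    (hω : ∀ k, 0 < (ω k).1) {t : ℝ} (ht : 0 ≤ t) :
    truncWeight lam nu V N x ω t ≤ if (position lam nu x ω t).isSome
      then ENNReal.ofReal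
        (Real.exp (-∫ s in (0 : ℝ)..t, (position lam nu x ω s).elim 0 V))
      else 0 := by
  rcases truncWeight_eq_zero_or (V := V) hq N (x := x) hω ht with h | ⟨h1, -, h3⟩
  · rw [h]; exact zero_le
  · rw [if_pos h1, h3]

lemma measurable_firstState (x : ℕ) : Measurable (firstState lam nu x) :=
  Measurable.ite (measurableSet_le measurable_snd measurable_const) measurable_const
    measurable_const

lemma measurable_firstTime (x : ℕ) : Measurable (firstTime lam nu x) :=
  measurable_fst.div_const _

lemma measurable_shift : Measurable shift :=
  measurable_pi_lambda _ fun n => measurable_pi_apply (n + 1)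

lemma measurable_truncWeight (N x : ℕ) :
    Measurable fun p : (ℕ → ℝ × ℝ) × ℝ => truncWeight lam nu V N x p.1 p.2 := by
  induction N generalizing x with
  | zero => exact measurable_const
  | succ N ih =>
    have h0 : Measurable fun p : (ℕ → ℝ × ℝ) × ℝ => p.1 0 :=
      (measurable_pi_apply 0).comp measurable_fst
    have hT : Measurable fun p : (ℕ → ℝ × ℝ) × ℝ => firstTime lam nu x (p.1 0) :=
      (measurable_firstTime x).comp h0
    have hS : Measurable fun p : (ℕ → ℝ × ℝ) × ℝ =>
        (shift p.1, p.2 - firstTime lam nu x (p.1 0)) :=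
      (measurable_shift.comp measurable_fst).prodMk (measurable_snd.sub hT)
    have hW : Measurable fun p : (ℕ → ℝ × ℝ) × ℝ =>
        truncWeight lam nu V N (firstState lam nu x (p.1 0)) (shift p.1)
          (p.2 - firstTime lam nu x (p.1 0)) := by
      -- The state after the jump is random, but countability of the state space gives joint
      -- measurability.
      have hc : Measurable fun r : ℕ × ((ℕ → ℝ × ℝ) × ℝ) =>
          truncWeight lam nu V N r.1 r.2.1 r.2.2 := measurable_from_prod_countable_right ih
      exact hc.comp (((measurable_firstState x).comp h0).prodMk hS)
    simp only [truncWeight]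
    refine Measurable.ite (measurableSet_lt measurable_snd hT) (by fun_prop) ?_
    exact (by fun_prop : Measurable fun p : (ℕ → ℝ × ℝ) × ℝ =>
      ENNReal.ofReal (Real.exp (-(V x * firstTime lam nu x (p.1 0))))).mul hW

end FirstStep
/-! ### The first-step recursion for the truncated Green function -/

section Green

open Set

/-- The sequence with first term `p` and remaining terms `ω`. -/
def prepend (p : ℝ × ℝ) (ω : ℕ → ℝ × ℝ) : ℕ → ℝ × ℝ
  | 0 => p
  | n + 1 => ω n

instance : IsProbabilityMeasure driving := by
  unfold driving; infer_instance

lemma measurable_prepend : Measurable fun r : (ℝ × ℝ) × (ℕ → ℝ × ℝ) => prepend r.1 r.2 := by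
  refine measurable_pi_lambda _ fun n => ?_
  cases n with
  | zero => exact measurable_fst
  | succ n => exact (measurable_pi_apply n).comp measurable_snd

/-- Independence of the first step from the later ones. It suffices to compare masses of finite
boxes, whose preimage separates coordinate `0` from the shifted coordinates. -/
lemma map_prepend_driving :
    (stepLaw.prod driving).map (fun r => prepend r.1 r.2) = driving := by
  refine Measure.eq_infinitePi _ fun s t ht => ?_
  rw [Measure.map_apply measurable_prepend (MeasurableSet.pi s.countable_toSet fun i _ => ht i)]
  classical
  set s' : Finset ℕ := s.preimage Nat.succ (Nat.succ_injective.injOn) with hs'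
  have hpre : (fun r : (ℝ × ℝ) × (ℕ → ℝ × ℝ) => prepend r.1 r.2) ⁻¹' (Set.pi s t) =
      (if 0 ∈ s then t 0 else univ) ×ˢ Set.pi s' (fun n => t (n + 1)) := by
    ext ⟨p, ω⟩
    simp only [mem_preimage, Set.mem_pi, Finset.mem_coe, mem_prod, hs', Finset.mem_preimage]
    constructor
    · intro h
      refine ⟨?_, fun n hn => h (n + 1) hn⟩
      split_ifs with h0
      · exact h 0 h0
      · trivial
    · rintro ⟨h0, h1⟩ (_ | n) hn
      · rwa [if_pos hn] at h0
      · exact h1 n hn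
  rw [hpre, Measure.prod_prod, driving, Measure.infinitePi_pi _ fun i _ => ht (i + 1)]
  by_cases h0 : 0 ∈ s
  · have hs : s = insert 0 (s'.image Nat.succ) := by
      ext n; cases n <;> simp [hs', h0]
    rw [if_pos h0]
    conv_rhs => rw [hs]
    rw [Finset.prod_insert (by simp), Finset.prod_image (by simp)]
  · have hs : s = s'.image Nat.succ := by
      ext n; cases n <;> simp [hs', h0]
    rw [if_neg h0, measure_univ, one_mul]
    conv_rhs => rw [hs]
    rw [Finset.prod_image (by simp)]

lemma lintegral_driving {F : (ℕ → ℝ × ℝ) → ENNReal} (hF : Measurable F) :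
    ∫⁻ ω, F ω ∂driving = ∫⁻ p, ∫⁻ ω, F (prepend p ω) ∂driving ∂stepLaw := by
  conv_lhs => rw [← map_prepend_driving]
  rw [lintegral_map hF measurable_prepend]
  exact lintegral_prod _ (hF.comp measurable_prepend).aemeasurable

lemma lintegral_expMeasure {F : ℝ → ENNReal} (hF : Measurable F) :
    ∫⁻ s, F s ∂expMeasure 1 = ∫⁻ s in Ioi (0 : ℝ), ENNReal.ofReal (Real.exp (-s)) * F s := by
  have h : expMeasure 1 = volume.withDensity (exponentialPDF 1) := rfl
  rw [h, lintegral_withDensity_eq_lintegral_mul _ (by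
    exact (measurable_exponentialPDFReal 1).ennreal_ofReal) hF, ← setLIntegral_univ,
    ← Iic_union_Ioi (a := (0 : ℝ)), lintegral_union measurableSet_Ioi (by
      rw [disjoint_left]; intro x hx hx'; exact absurd (mem_Iic.1 hx) (not_le.2 hx')),
    ← restrict_Iio_eq_restrict_Iic, setLIntegral_congr_fun (g := fun _ => 0) measurableSet_Iio,
    lintegral_zero, zero_add]
  · refine setLIntegral_congr_fun measurableSet_Ioi fun s hs => ?_
    simp [exponentialPDF_of_nonneg (le_of_lt hs)]
  · intro s hs
    simp [exponentialPDF_of_neg hs]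

lemma ae_expMeasure_pos : ∀ᵐ s ∂expMeasure 1, 0 < s := by
  have h := lintegral_expMeasure (F := (Iic (0 : ℝ)).indicator 1)
    (measurable_one.indicator measurableSet_Iic)
  rw [lintegral_indicator_one measurableSet_Iic, setLIntegral_congr_fun (g := fun _ => 0)
    measurableSet_Ioi, lintegral_zero] at h
  · rw [ae_iff]; simpa [not_lt, Iic] using h
  · intro s hs
    simp [not_le.2 (mem_Ioi.1 hs)]

lemma ae_stepLaw_pos : ∀ᵐ p ∂stepLaw, 0 < p.1 := by
  have : IsProbabilityMeasure (volume.restrict (Set.Icc (0 : ℝ) 1)) := ⟨by simp⟩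
  have h : MeasurePreserving Prod.fst stepLaw (expMeasure 1) := by
    have : IsProbabilityMeasure (expMeasure 1) := isProbabilityMeasure_expMeasure one_pos
    exact measurePreserving_fst
  exact h.quasiMeasurePreserving.ae ae_expMeasure_pos

lemma ae_driving_pos : ∀ᵐ ω ∂driving, ∀ k, 0 < (ω k).1 := by
  rw [ae_all_iff]
  intro k
  exact (measurePreserving_eval_infinitePi (fun _ : ℕ => stepLaw) k).quasiMeasurePreserving.ae
    ae_stepLaw_pos

lemma expMeasure_Ioi {c : ℝ} (hc : 0 ≤ c) :
    expMeasure 1 (Ioi c) = ENNReal.ofReal (Real.exp (-c)) := by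
  have : IsProbabilityMeasure (expMeasure 1) := isProbabilityMeasure_expMeasure one_pos
  have h : expMeasure 1 = volume.withDensity (exponentialPDF 1) := rfl
  have h1 : expMeasure 1 (Iic c) = ENNReal.ofReal (1 - Real.exp (-c)) := by
    rw [h, withDensity_apply _ measurableSet_Iic, lintegral_exponentialPDF_eq_antiDeriv one_pos,
      if_pos hc, one_mul]
  have he : Real.exp (-c) ≤ 1 := Real.exp_le_one_iff.2 (neg_nonpos.2 hc)
  rw [← compl_Iic, prob_compl_eq_one_sub measurableSet_Iic, h1, ← ENNReal.ofReal_one,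
    ← ENNReal.ofReal_sub _ (by linarith), sub_sub_cancel]

lemma lintegral_Ioi_exp_neg_mul {c : ℝ} (hc : 0 < c) :
    ∫⁻ s in Ioi (0 : ℝ), ENNReal.ofReal (Real.exp (-(c * s))) = ENNReal.ofReal c⁻¹ := by
  rw [← ofReal_integral_eq_lintegral_ofReal]
  · congr 1
    have := integral_exp_mul_Ioi (neg_lt_zero.2 hc) 0
    simpa [neg_mul] using this
  · simpa [neg_mul, IntegrableOn] using exp_neg_integrableOn_Ioi 0 hc
  · exact Filter.Eventually.of_forall fun s => (Real.exp_pos _).le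

variable {lam nu V : ℕ → ℝ}

/-- A step of the embedded chain: mean of a function of the new state. -/
lemma lintegral_firstState (hlam : ∀ x, 0 < lam x) (hnu : ∀ x, 0 ≤ nu x) (g : ℕ → ENNReal)
    (x : ℕ) (s : ℝ) :
    ∫⁻ v in Icc (0 : ℝ) 1, g (firstState lam nu x (s, v)) =
      ENNReal.ofReal (lam x / (lam x + nu x)) * g (x + 1) +
        ENNReal.ofReal (nu x / (lam x + nu x)) * g (x - 1) := by
  have hq : 0 < lam x + nu x := add_pos_of_pos_of_nonneg (hlam x) (hnu x)
  set p := lam x / (lam x + nu x) with hp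
  have hp0 : 0 ≤ p := div_nonneg (hlam x).le hq.le
  have hp1 : p ≤ 1 := (div_le_one hq).2 (by linarith [hnu x])
  have hp' : nu x / (lam x + nu x) = 1 - p := by rw [hp]; field_simp; ring
  rw [← Icc_union_Ioc_eq_Icc hp0 hp1, lintegral_union measurableSet_Ioc (by
      rw [disjoint_left]; intro v hv hv'; exact absurd hv.2 (not_le.2 hv'.1)),
    setLIntegral_congr_fun (g := fun _ => g (x + 1)) measurableSet_Icc,
    setLIntegral_congr_fun (g := fun _ => g (x - 1)) measurableSet_Ioc,
    setLIntegral_const, setLIntegral_const, Real.volume_Icc, Real.volume_Ioc, sub_zero, hp',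
    mul_comm, mul_comm (g (x - 1))]
  · intro v hv
    simp only [firstState, ← hp, if_neg (not_le.2 hv.1)]
  · intro v hv
    simp only [firstState, ← hp, if_pos hv.2]

variable (lam nu V) in
/-- The Green function of the Feynman-Kac semigroup for paths with fewer than `N` jumps. -/
noncomputable def truncGreen (N x : ℕ) : ENNReal :=
  ∫⁻ ω, (∫⁻ t in Ioi (0 : ℝ), truncWeight lam nu V N x ω t) ∂driving

lemma measurable_lintegral_truncWeight (N x : ℕ) :
    Measurable fun ω => ∫⁻ t in Ioi (0 : ℝ), truncWeight lam nu V N x ω t :=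
  Measurable.lintegral_prod_right' (measurable_truncWeight N x)

/-- Tonelli is applied to the measurable truncated weight only; the comparison with the full weight
is pointwise, so measurability of `position` plays no role. -/
lemma truncGreen_le (hq : ∀ x, 0 < lam x + nu x) (N x : ℕ) :
    truncGreen lam nu V N x ≤ ∫⁻ t in Ioi (0 : ℝ), ⨆ x : ℕ, feynmanKac lam nu V t x := by
  rw [truncGreen, lintegral_lintegral_swap (measurable_truncWeight N x).aemeasurable]
  refine setLIntegral_mono' measurableSet_Ioi fun t ht => ?_
  refine le_trans ?_ (le_iSup _ x)
  exact lintegral_mono_ae (ae_driving_pos.mono fun ω hω => truncWeight_le hq N hω (le_of_lt ht))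

lemma lintegral_truncWeight_prepend (N x : ℕ) (p : ℝ × ℝ) (ω : ℕ → ℝ × ℝ)
    (hp : 0 ≤ firstTime lam nu x p) :
    ∫⁻ t in Ioi (0 : ℝ), truncWeight lam nu V (N + 1) x (prepend p ω) t =
      (∫⁻ t in Ioo 0 (firstTime lam nu x p), ENNReal.ofReal (Real.exp (-(V x * t)))) +
        ENNReal.ofReal (Real.exp (-(V x * firstTime lam nu x p))) *
          ∫⁻ t in Ioi (0 : ℝ), truncWeight lam nu V N (firstState lam nu x p) ω t := by
  set σ := firstTime lam nu x p with hσ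
  have hpt (t : ℝ) : truncWeight lam nu V (N + 1) x (prepend p ω) t =
      if t < σ then ENNReal.ofReal (Real.exp (-(V x * t)))
      else ENNReal.ofReal (Real.exp (-(V x * σ))) *
        truncWeight lam nu V N (firstState lam nu x p) ω (t - σ) := rfl
  conv_lhs => rw [← Ioc_union_Ioi_eq_Ioi hp]
  rw [lintegral_union measurableSet_Ioi (by
      rw [disjoint_left]; intro t ht ht'; exact absurd ht.2 (not_le.2 ht')),
    ← restrict_Ioo_eq_restrict_Ioc]
  congr 1
  · refine setLIntegral_congr_fun measurableSet_Ioo fun t ht => ?_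
    simp only [hpt, if_pos ht.2]
  · have hmp := (measurePreserving_sub_right (volume : Measure ℝ) σ)
    have he := MeasurableEquiv.measurableEmbedding (MeasurableEquiv.subRight σ)
    have := hmp.setLIntegral_comp_preimage_emb he (fun t => ENNReal.ofReal (Real.exp (-(V x * σ))) *
        truncWeight lam nu V N (firstState lam nu x p) ω t) (Ioi 0)
    conv_rhs => rw [← lintegral_const_mul' _ _ ENNReal.ofReal_ne_top, ← this]
    have hset : (fun t => t - σ) ⁻¹' Ioi (0 : ℝ) = Ioi σ := by ext t; simp
    rw [hset]
    refine setLIntegral_congr_fun measurableSet_Ioi fun t ht => ?_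
    simp only [hpt, if_neg (not_lt.2 (le_of_lt (mem_Ioi.1 ht)))]

/-- Condition on the first jump. `V` may be negative; only total rate plus `V` must be positive for
the exponential integrals to converge. -/
lemma truncGreen_succ (hlam : ∀ x, 0 < lam x) (hnu : ∀ x, 0 ≤ nu x)
    (hV : ∀ x, 0 < lam x + nu x + V x) (N x : ℕ) :
    truncGreen lam nu V (N + 1) x = ENNReal.ofReal (lam x + nu x + V x)⁻¹ *
      (1 + ENNReal.ofReal (lam x) * truncGreen lam nu V N (x + 1) +
        ENNReal.ofReal (nu x) * truncGreen lam nu V N (x - 1)) := by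
  have hq : 0 < lam x + nu x := add_pos_of_pos_of_nonneg (hlam x) (hnu x)
  set q := lam x + nu x with hqdef
  have : IsProbabilityMeasure (expMeasure 1) := isProbabilityMeasure_expMeasure one_pos
  have hIP : IsProbabilityMeasure (volume.restrict (Set.Icc (0 : ℝ) 1)) := ⟨by simp⟩
  have hi (s : ℝ) : ∫⁻ t in Ioo 0 (s / q), ENNReal.ofReal (Real.exp (-(V x * t))) =
      ∫⁻ t in Ioi (0 : ℝ), (if t < s / q then ENNReal.ofReal (Real.exp (-(V x * t))) else 0) := by
    rw [← Ioi_inter_Iio, inter_comm, ← Measure.restrict_restrict measurableSet_Iio,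
      ← lintegral_indicator measurableSet_Iio]
    rfl
  have hmi : Measurable fun r : ℝ × ℝ =>
      if r.2 < r.1 / q then ENNReal.ofReal (Real.exp (-(V x * r.2))) else 0 :=
    Measurable.ite (measurableSet_lt measurable_snd (by fun_prop)) (by fun_prop) measurable_const
  have hmΦ : Measurable fun s : ℝ =>
      ∫⁻ t in Ioo 0 (s / q), ENNReal.ofReal (Real.exp (-(V x * t))) := by
    simp only [hi]
    exact hmi.lintegral_prod_right'
  have h1 : truncGreen lam nu V (N + 1) x = ∫⁻ p, ((∫⁻ t in Ioo 0 (p.1 / q),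
      ENNReal.ofReal (Real.exp (-(V x * t)))) + ENNReal.ofReal (Real.exp (-(V x * (p.1 / q)))) *
          truncGreen lam nu V N (firstState lam nu x p)) ∂stepLaw := by
    rw [truncGreen, lintegral_driving (measurable_lintegral_truncWeight _ _)]
    refine lintegral_congr_ae (ae_stepLaw_pos.mono fun p hp => ?_)
    have hp' : 0 ≤ firstTime lam nu x p := (div_pos hp hq).le
    simp only [lintegral_truncWeight_prepend N x p _ hp']
    rw [lintegral_add_right _ ((measurable_lintegral_truncWeight _ _).const_mul _),
      lintegral_const_mul _ (measurable_lintegral_truncWeight _ _), lintegral_const, measure_univ,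
      mul_one]
    rfl
  have h2 : truncGreen lam nu V (N + 1) x = ∫⁻ s, ((∫⁻ t in Ioo 0 (s / q),
      ENNReal.ofReal (Real.exp (-(V x * t)))) + ENNReal.ofReal (Real.exp (-(V x * (s / q)))) *
          (ENNReal.ofReal (lam x / q) * truncGreen lam nu V N (x + 1) +
        ENNReal.ofReal (nu x / q) * truncGreen lam nu V N (x - 1))) ∂expMeasure 1 := by
    have hmg : Measurable fun p : ℝ × ℝ => truncGreen lam nu V N (firstState lam nu x p) :=
      (measurable_of_countable (truncGreen lam nu V N)).comp (measurable_firstState x)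
    rw [h1, stepLaw, lintegral_prod _ (by
      exact ((hmΦ.comp measurable_fst).add ((by fun_prop : Measurable fun p : ℝ × ℝ =>
        ENNReal.ofReal (Real.exp (-(V x * (p.1 / q))))).mul hmg)).aemeasurable)]
    refine lintegral_congr fun s => ?_
    have hmg' : Measurable fun v : ℝ => truncGreen lam nu V N (firstState lam nu x (s, v)) :=
      hmg.comp measurable_prodMk_left
    dsimp only
    rw [lintegral_add_right _ (hmg'.const_mul _), lintegral_const, measure_univ, mul_one,
      lintegral_const_mul _ hmg', lintegral_firstState hlam hnu]
  -- By Tonelli this is the integral of `exp (-V t)` times the probability `exp (-q t)` of no jump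
  -- before `t`.
  have hA : ∫⁻ s, (∫⁻ t in Ioo 0 (s / q), ENNReal.ofReal (Real.exp (-(V x * t)))) ∂expMeasure 1 =
      ENNReal.ofReal (q + V x)⁻¹ := by
    simp only [hi]
    rw [lintegral_lintegral_swap hmi.aemeasurable, ← lintegral_Ioi_exp_neg_mul (hV x)]
    refine setLIntegral_congr_fun measurableSet_Ioi fun t ht => ?_
    have hind (s : ℝ) : (if t < s / q then ENNReal.ofReal (Real.exp (-(V x * t))) else 0) =
        (Ioi (q * t)).indicator (fun _ => ENNReal.ofReal (Real.exp (-(V x * t)))) s := by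
      simp only [indicator, mem_Ioi, lt_div_iff₀' hq]
    simp only [hind]
    rw [lintegral_indicator_const measurableSet_Ioi,
      expMeasure_Ioi (mul_nonneg hq.le (le_of_lt ht)), ← ENNReal.ofReal_mul (Real.exp_pos _).le,
      ← Real.exp_add]
    congr 2
    ring
  have hB : ∫⁻ s, ENNReal.ofReal (Real.exp (-(V x * (s / q)))) ∂expMeasure 1 =
      ENNReal.ofReal (q + V x)⁻¹ * ENNReal.ofReal q := by
    rw [lintegral_expMeasure (by fun_prop), ← ENNReal.ofReal_mul (by have := hV x; positivity)]
    have hc : 0 < (q + V x) / q := div_pos (hV x) hq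
    have : (q + V x)⁻¹ * q = ((q + V x) / q)⁻¹ := by rw [inv_div, div_eq_inv_mul]
    rw [this, ← lintegral_Ioi_exp_neg_mul hc]
    refine lintegral_congr fun s => ?_
    rw [← ENNReal.ofReal_mul (Real.exp_pos _).le, ← Real.exp_add]
    congr 2
    field_simp
    ring
  have hdiv {r : ℝ} (hr : 0 ≤ r) : ENNReal.ofReal q * ENNReal.ofReal (r / q) = ENNReal.ofReal r := by
    rw [← ENNReal.ofReal_mul hq.le, mul_div_cancel₀ _ hq.ne']
  rw [h2, lintegral_add_left hmΦ, lintegral_mul_const _ (by fun_prop), hA, hB, add_assoc 1,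
    mul_add _ 1, mul_one, mul_assoc, mul_add, ← mul_assoc, ← mul_assoc, hdiv (hlam x).le, hdiv (hnu x)]

/-- `G` is the increasing limit of the truncated Green functions: the uniform bound makes it finite,
and the one-step recursion passes to the limit. -/
lemma exists_green (hlam : ∀ x, 0 < lam x) (hnu : ∀ x, 0 ≤ nu x)
    (hV : ∀ x, 0 < lam x + nu x + V x) {K : ENNReal} (hK : K < ⊤)
    (hle : ∫⁻ t in Ioi (0 : ℝ), ⨆ x : ℕ, feynmanKac lam nu V t x ≤ K) :
    ∃ G : ℕ → ℝ, ∀ x, 0 < G x ∧ G x ≤ K.toReal ∧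
      (lam x + nu x + V x) * G x = 1 + lam x * G (x + 1) + nu x * G (x - 1) := by
  have hq (x : ℕ) : 0 < lam x + nu x := add_pos_of_pos_of_nonneg (hlam x) (hnu x)
  have hgK (N x : ℕ) : truncGreen lam nu V N x ≤ K := (truncGreen_le hq N x).trans hle
  have hgt (N x : ℕ) : truncGreen lam nu V N x ≠ ⊤ := ((hgK N x).trans_lt hK).ne
  set g : ℕ → ℕ → ℝ := fun N x => (truncGreen lam nu V N x).toReal with hg
  have hg0 (N x : ℕ) : 0 ≤ g N x := ENNReal.toReal_nonneg
  have hbd (N x : ℕ) : g N x ≤ K.toReal := ENNReal.toReal_mono hK.ne (hgK N x)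
  have hrec (N x : ℕ) : g (N + 1) x = (lam x + nu x + V x)⁻¹ *
      (1 + lam x * g N (x + 1) + nu x * g N (x - 1)) := by
    simp only [hg]
    rw [truncGreen_succ hlam hnu hV, ENNReal.toReal_mul,
      ENNReal.toReal_ofReal (inv_nonneg.2 (hV x).le), ENNReal.toReal_add
        (by finiteness [hgt N (x + 1)]) (by finiteness [hgt N (x - 1)]),
      ENNReal.toReal_add (by finiteness) (by finiteness [hgt N (x + 1)]),
      ENNReal.toReal_mul, ENNReal.toReal_mul, ENNReal.toReal_ofReal (hlam x).le,
      ENNReal.toReal_ofReal (hnu x), ENNReal.toReal_one]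
  have hzero (x : ℕ) : g 0 x = 0 := by simp [hg, truncGreen, truncWeight]
  have hstep (N : ℕ) : ∀ x, g N x ≤ g (N + 1) x := by
    induction N with
    | zero => intro x; rw [hzero]; exact hg0 1 x
    | succ N ih =>
      intro x
      rw [hrec N, hrec (N + 1)]
      have h1 := mul_le_mul_of_nonneg_left (ih (x + 1)) (hlam x).le
      have h2 := mul_le_mul_of_nonneg_left (ih (x - 1)) (hnu x)
      exact mul_le_mul_of_nonneg_left (by linarith) (inv_nonneg.2 (hV x).le)
  have hmono (x : ℕ) : Monotone fun N => g N x := monotone_nat_of_le_succ fun N => hstep N x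
  have hB (x : ℕ) : BddAbove (range fun N => g N x) := ⟨K.toReal, by
    rintro _ ⟨N, rfl⟩; exact hbd N x⟩
  have hlim (x : ℕ) := tendsto_atTop_ciSup (hmono x) (hB x)
  refine ⟨fun x => ⨆ N, g N x, fun x => ⟨?_, ciSup_le fun N => hbd N x, ?_⟩⟩
  · refine lt_of_lt_of_le ?_ (le_ciSup (hB x) 1)
    simp only [hrec, hzero, mul_zero, add_zero, mul_one]
    exact inv_pos.2 (hV x)
  · have h1 := (hlim x).comp (Filter.tendsto_add_atTop_nat 1)
    have h2 := (((((hlim (x + 1)).const_mul (lam x)).const_add 1).add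
      ((hlim (x - 1)).const_mul (nu x))).const_mul (lam x + nu x + V x)⁻¹)
    have h3 := tendsto_nhds_unique h1 (h2.congr fun N => (hrec N x).symm)
    dsimp only at h3 ⊢
    rw [h3, mul_inv_cancel_left₀ (hV x).ne']

end Green
/-! ### The stationary distribution -/

section Stationary

variable {lam nu u : ℕ → ℝ}

lemma IsErgodic.prod_pos (h : IsErgodic lam nu) (x : ℕ) :
    0 < ∏ y ∈ Finset.range x, lam y / nu (y + 1) :=
  Finset.prod_pos fun y _ => div_pos (h.birth_pos y) (h.death_pos y)

lemma IsErgodic.tsum_prod_pos (h : IsErgodic lam nu) :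
    0 < ∑' z : ℕ, ∏ y ∈ Finset.range z, lam y / nu (y + 1) :=
  h.positive_recurrent.tsum_pos (fun x => (h.prod_pos x).le) 0 (h.prod_pos 0)

lemma IsErgodic.mass_pos (h : IsErgodic lam nu) (x : ℕ) : 0 < stationaryMass lam nu x :=
  mul_pos (inv_pos.2 h.tsum_prod_pos) (h.prod_pos x)

lemma IsErgodic.hasSum_mass (h : IsErgodic lam nu) : HasSum (stationaryMass lam nu) 1 := by
  have := h.positive_recurrent.hasSum.mul_left
    (∑' z : ℕ, ∏ y ∈ Finset.range z, lam y / nu (y + 1))⁻¹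
  rwa [inv_mul_cancel₀ h.tsum_prod_pos.ne'] at this

lemma IsErgodic.death_nonneg (h : IsErgodic lam nu) (x : ℕ) : 0 ≤ nu x := by
  cases x with
  | zero => exact h.death_zero.ge
  | succ x => exact (h.death_pos x).le

/-- Detailed balance. -/
lemma IsErgodic.balance (h : IsErgodic lam nu) (x : ℕ) :
    nu (x + 1) * stationaryMass lam nu (x + 1) = lam x * stationaryMass lam nu x := by
  rw [stationaryMass, stationaryMass, Finset.prod_range_succ]
  have := (h.death_pos x).ne'
  field_simp

lemma lintegral_stationary (F : ℕ → ENNReal) :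
    ∫⁻ x, F x ∂stationary lam nu = ∑' x, ENNReal.ofReal (stationaryMass lam nu x) * F x := by
  simp [stationary, lintegral_sum_measure]

lemma stationary_singleton (x : ℕ) :
    stationary lam nu {x} = ENNReal.ofReal (stationaryMass lam nu x) := by
  rw [← lintegral_indicator_one (measurableSet_singleton x), lintegral_stationary,
    tsum_eq_single x fun y hy => by simp [hy]]
  simp

lemma IsErgodic.isProbabilityMeasure (h : IsErgodic lam nu) :
    IsProbabilityMeasure (stationary lam nu) := by
  constructor
  rw [← lintegral_one, lintegral_stationary]
  simp only [mul_one]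
  rw [← ENNReal.ofReal_tsum_of_nonneg (fun x => (h.mass_pos x).le) h.hasSum_mass.summable,
    h.hasSum_mass.tsum_eq, ENNReal.ofReal_one]

lemma lintegral_ofReal_stationary (h : IsErgodic lam nu) (F : ℕ → ℝ) :
    ∫⁻ x, ENNReal.ofReal (F x) ∂stationary lam nu =
      ∑' x, ENNReal.ofReal (stationaryMass lam nu x * F x) := by
  rw [lintegral_stationary]
  exact tsum_congr fun x => (ENNReal.ofReal_mul (h.mass_pos x).le).symm

lemma HasDensity.hasSum (h : IsErgodic lam nu) {π : Measure ℕ} {f : ℕ → ℝ}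
    (hf : HasDensity lam nu π f) : HasSum (fun x => stationaryMass lam nu x * f x) 1 := by
  obtain ⟨hp, h0, rfl⟩ := hf
  have h1 := hp.measure_univ
  rw [withDensity_apply _ MeasurableSet.univ, Measure.restrict_univ,
    lintegral_ofReal_stationary h] at h1
  have hnn (x : ℕ) : 0 ≤ stationaryMass lam nu x * f x := mul_nonneg (h.mass_pos x).le (h0 x)
  have hs : Summable fun x => stationaryMass lam nu x * f x := by
    have := ENNReal.summable_toReal (f := fun x => ENNReal.ofReal (stationaryMass lam nu x * f x))
      (by rw [h1]; exact ENNReal.one_ne_top)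
    simpa only [ENNReal.toReal_ofReal (hnn _)] using this
  rw [← ENNReal.ofReal_tsum_of_nonneg hnn hs] at h1
  have h2 := congrArg ENNReal.toReal h1
  rw [ENNReal.toReal_ofReal (tsum_nonneg hnn), ENNReal.toReal_one] at h2
  exact h2 ▸ hs.hasSum

lemma HasDensity.singleton {π : Measure ℕ} {f : ℕ → ℝ} (h : IsErgodic lam nu)
    (hf : HasDensity lam nu π f) (x : ℕ) :
    π {x} = ENNReal.ofReal (stationaryMass lam nu x * f x) := by
  rw [hf.2.2, withDensity_apply _ (measurableSet_singleton x), lintegral_singleton,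
    stationary_singleton, mul_comm, ← ENNReal.ofReal_mul (h.mass_pos x).le]

lemma measure_Iic_eq_sum (m : Measure ℕ) (x : ℕ) :
    m (Set.Iic x) = ∑ y ∈ Finset.range (x + 1), m {y} := by
  rw [sum_measure_singleton]
  congr 1
  ext y
  simp

end Stationary

/-! ### The Poisson equation and the kernel bound -/

section Kernel

variable {lam nu u : ℕ → ℝ}

/-- Indicator of the half-open interval from `p.1` to `p.2`. -/
noncomputable def between (p : ℕ × ℕ) (x : ℕ) : ENNReal := if p.1 ≤ x ∧ x < p.2 then 1 else 0

lemma hasSum_ite_lt {h : ℕ → ℝ} {S : ℝ} (hS : HasSum h S) (z : ℕ) :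
    HasSum (fun y => if z < y then h y else 0) (S - ∑ y ∈ Finset.range (z + 1), h y) := by
  have h1 : HasSum (fun y => if y ∈ Finset.range (z + 1) then h y else 0)
      (∑ y ∈ Finset.range (z + 1), h y) := by
    have := hasSum_sum_of_ne_finset_zero (L := .unconditional ℕ)
      (f := fun y => if y ∈ Finset.range (z + 1) then h y else 0)
      (s := Finset.range (z + 1)) (fun y hy => if_neg hy)
    rwa [Finset.sum_congr rfl fun y hy => if_pos hy] at this
  have h2 : (fun y => if z < y then h y else 0) =
      fun y => h y - if y ∈ Finset.range (z + 1) then h y else 0 := by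
    funext y
    by_cases hy : z < y
    · rw [if_pos hy, if_neg (by simpa using hy), sub_zero]
    · rw [if_neg hy, if_pos (by simpa [Nat.lt_succ_iff] using hy), sub_self]
  rw [h2]
  exact hS.sub h1

lemma tsum_between_mul (g : ℕ → ENNReal) (p : ℕ × ℕ) :
    ∑' x, between p x * g x = ∑ x ∈ Finset.Ico p.1 p.2, g x := by
  rw [tsum_eq_sum (s := Finset.Ico p.1 p.2)]
  · refine Finset.sum_congr rfl fun x hx => ?_
    rw [between, if_pos (Finset.mem_Ico.1 hx), one_mul]
  · intro x hx
    rw [between, if_neg (by simpa using hx), zero_mul]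

lemma tsum_between_eq {M : ℕ × ℕ → ENNReal} (z : ℕ) :
    ∑' p, between p z * M p =
      ∑ y ∈ Finset.range (z + 1), ∑' y', if z < y' then M (y, y') else 0 := by
  rw [ENNReal.tsum_prod', tsum_eq_sum (s := Finset.range (z + 1))]
  · refine Finset.sum_congr rfl fun y hy => tsum_congr fun y' => ?_
    have : y ≤ z := by simpa [Nat.lt_succ_iff] using hy
    simp [between, this]
  · intro y hy
    have : ¬ y ≤ z := by simpa [Nat.lt_succ_iff] using hy
    simp [between, this]

/-- The sum equals `lam z * m z * u z * G z` with `G` the Green function, so both bounds are those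
on `G`. The constant `c` is the flux `lam 0 * u 0 * G 0` out of the origin. -/
lemma IsErgodic.exists_poisson (h : IsErgodic lam nu) (hu : ∀ x, 0 < u x)
    (hκ : kappa lam nu u < ⊤) :
    0 < (kappa lam nu u).toReal ∧ ∃ c : ℝ, ∀ z,
      0 < ∑ y ∈ Finset.range (z + 1), stationaryMass lam nu y *
        (c - ∑ i ∈ Finset.range y, u i) ∧
      ∑ y ∈ Finset.range (z + 1), stationaryMass lam nu y * (c - ∑ i ∈ Finset.range y, u i) ≤
        (kappa lam nu u).toReal * (lam z * stationaryMass lam nu z * u z) := by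
  have hV (x : ℕ) : modBirth lam u x + modDeath nu u x + potential lam nu u x =
      nu (x + 1) + lam x := by rw [potential]; ring
  obtain ⟨G, hG⟩ := exists_green (lam := modBirth lam u) (nu := modDeath nu u)
    (V := potential lam nu u)
    (fun x => mul_pos (div_pos (hu _) (hu _)) (h.birth_pos _))
    (fun x => mul_nonneg (div_pos (hu _) (hu _)).le (h.death_nonneg _))
    (fun x => by rw [hV]; exact add_pos (h.death_pos x) (h.birth_pos x)) hκ le_rfl
  refine ⟨(hG 0).1.trans_le (hG 0).2.1, lam 0 * (u 0 * G 0), ?_⟩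
  have heq (x : ℕ) : (nu (x + 1) + lam x) * (u x * G x) =
      u x + lam (x + 1) * (u (x + 1) * G (x + 1)) + nu x * (u (x - 1) * G (x - 1)) := by
    have := (hG x).2.2
    rw [hV, modBirth, modDeath] at this
    have hux := (hu x).ne'
    calc _ = u x * ((nu (x + 1) + lam x) * G x) := by ring
      _ = _ := by rw [this]; field_simp
  -- The equation `heq` expresses the increment of the left side as `-u x`; it telescopes from `nu 0
  -- = 0`.
  have hdiff (x : ℕ) : lam (x + 1) * (u (x + 1) * G (x + 1)) - nu (x + 1) * (u x * G x) =
      lam 0 * (u 0 * G 0) - ∑ i ∈ Finset.range (x + 1), u i := by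
    induction x with
    | zero =>
      have := heq 0
      rw [h.death_zero] at this
      rw [Finset.sum_range_one]
      linarith
    | succ x ih =>
      have := heq (x + 1)
      rw [Nat.add_sub_cancel] at this
      rw [Finset.sum_range_succ]
      linarith
  -- Multiplied by the mass, `hdiff` telescopes by detailed balance.
  have hsum (z : ℕ) : ∑ y ∈ Finset.range (z + 1), stationaryMass lam nu y *
      (lam 0 * (u 0 * G 0) - ∑ i ∈ Finset.range y, u i) =
      lam z * stationaryMass lam nu z * (u z * G z) := by
    induction z with
    | zero => simp; ring
    | succ z ih =>
      rw [Finset.sum_range_succ, ih, ← hdiff z, ← h.balance z]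
      ring
  intro z
  rw [hsum]
  have hlm := mul_pos (h.birth_pos z) (h.mass_pos z)
  refine ⟨mul_pos hlm (mul_pos (hu z) (hG z).1), ?_⟩
  have := mul_le_mul_of_nonneg_left (hG z).2.1 (mul_pos hlm (hu z)).le
  linarith

/-- With `A` the mean of `ρ`, and `F`, `R` the sums of `m` and `m * ρ` up to `z`, the kernel is `F *
(A - R) - R * (1 - F) = F * A - R`. Since `A ≤ c`, it is at most `c * F - R`, which the Poisson
bound controls. -/
lemma IsErgodic.kernel_le (h : IsErgodic lam nu) (hu : ∀ x, 0 < u x)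
    (hκ : kappa lam nu u < ⊤) (z : ℕ) :
    ∑' p : ℕ × ℕ, between p z * (ENNReal.ofReal (stationaryMass lam nu p.1) *
        ENNReal.ofReal (stationaryMass lam nu p.2) *
        ∑ x ∈ Finset.Ico p.1 p.2, ENNReal.ofReal (u x)) ≤
      ENNReal.ofReal ((kappa lam nu u).toReal * (lam z * stationaryMass lam nu z * u z)) := by
  obtain ⟨-, c, hc⟩ := h.exists_poisson hu hκ
  set m := stationaryMass lam nu with hm
  set ρ : ℕ → ℝ := fun y => ∑ i ∈ Finset.range y, u i with hρ
  have hm0 (y : ℕ) : 0 < m y := h.mass_pos y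
  have hρ0 (y : ℕ) : 0 ≤ ρ y := Finset.sum_nonneg fun i _ => (hu i).le
  have hc0 : 0 < c := by
    have := (hc 0).1
    simp only [zero_add, Finset.sum_range_one, Finset.sum_range_zero, sub_zero] at this
    exact pos_of_mul_pos_right this (hm0 0).le
  have hsplit (z : ℕ) : ∑ y ∈ Finset.range (z + 1), m y * (c - ∑ i ∈ Finset.range y, u i) =
      c * ∑ y ∈ Finset.range (z + 1), m y - ∑ y ∈ Finset.range (z + 1), m y * ρ y := by
    rw [Finset.mul_sum, ← Finset.sum_sub_distrib]
    exact Finset.sum_congr rfl fun y _ => by ring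
  have hF1 (z : ℕ) : ∑ y ∈ Finset.range (z + 1), m y ≤ 1 :=
    sum_le_hasSum _ (fun y _ => (hm0 y).le) h.hasSum_mass
  -- Positivity in the Poisson lemma gives `R < c * F ≤ c`; thus `ρ` is integrable with mean at most
  -- `c`.
  have hpart (z : ℕ) : ∑ y ∈ Finset.range z, m y * ρ y ≤ c := by
    refine (Finset.sum_le_sum_of_subset_of_nonneg (Finset.range_mono (Nat.le_succ z))
      fun y _ _ => mul_nonneg (hm0 y).le (hρ0 y)).trans ?_
    have h1 := (hc z).1
    rw [hsplit] at h1
    have h2 := mul_le_mul_of_nonneg_left (hF1 z) hc0.le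
    linarith
  have hS : Summable fun y => m y * ρ y :=
    summable_of_sum_range_le (fun y => mul_nonneg (hm0 y).le (hρ0 y)) hpart
  set A := ∑' y, m y * ρ y with hA
  have hAc : A ≤ c := hS.tsum_le_of_sum_range_le hpart
  set F := ∑ y ∈ Finset.range (z + 1), m y with hF
  set R := ∑ y ∈ Finset.range (z + 1), m y * ρ y with hR
  have hρmono : Monotone ρ := fun a b hab =>
    Finset.sum_le_sum_of_subset_of_nonneg (Finset.range_mono hab) fun i _ _ => (hu i).le
  have hinner (y : ℕ) (hy : y ≤ z) : ∑' y', (if z < y' then ENNReal.ofReal (m y) *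
      ENNReal.ofReal (m y') * ∑ x ∈ Finset.Ico y y', ENNReal.ofReal (u x) else 0) =
      ENNReal.ofReal (m y * ((A - R) - ρ y * (1 - F))) := by
    have h1 := ((hasSum_ite_lt hS.hasSum z).sub
      ((hasSum_ite_lt h.hasSum_mass z).mul_left (ρ y))).mul_left (m y)
    rw [← h1.tsum_eq, ENNReal.ofReal_tsum_of_nonneg _ h1.summable]
    · refine tsum_congr fun y' => ?_
      split_ifs with hz
      · rw [← ENNReal.ofReal_mul (hm0 y).le, ← ENNReal.ofReal_sum_of_nonneg fun i _ => (hu i).le,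
          ← ENNReal.ofReal_mul (mul_pos (hm0 y) (hm0 y')).le,
          Finset.sum_Ico_eq_sub _ (by omega : y ≤ y')]
        congr 1
        ring
      · simp
    · intro y'
      split_ifs with hz
      · have h2 := mul_nonneg (hm0 y').le (sub_nonneg.2 (hρmono (by omega : y ≤ y')))
        exact mul_nonneg (hm0 y).le (by rw [← hm]; linarith)
      · simp
  have hnn (y : ℕ) (hy : y ≤ z) : 0 ≤ m y * ((A - R) - ρ y * (1 - F)) := by
    have h1 := ((hasSum_ite_lt hS.hasSum z).sub
      ((hasSum_ite_lt h.hasSum_mass z).mul_left (ρ y)))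
    refine mul_nonneg (hm0 y).le (h1.nonneg fun y' => ?_)
    split_ifs with hz
    · have h2 := mul_nonneg (hm0 y').le (sub_nonneg.2 (hρmono (by omega : y ≤ y')))
      rw [← hm]; linarith
    · simp
  rw [tsum_between_eq, Finset.sum_congr rfl fun y hy =>
    hinner y (by simpa [Nat.lt_succ_iff] using hy),
    ← ENNReal.ofReal_sum_of_nonneg fun y hy => hnn y (by simpa [Nat.lt_succ_iff] using hy)]
  refine ENNReal.ofReal_le_ofReal (le_trans ?_ (hc z).2)
  rw [hsplit]
  have : ∑ y ∈ Finset.range (z + 1), m y * ((A - R) - ρ y * (1 - F)) =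
      F * (A - R) - R * (1 - F) := by
    rw [hF, Finset.sum_mul, hR, Finset.sum_mul, ← Finset.sum_sub_distrib]
    exact Finset.sum_congr rfl fun y _ => by ring
  rw [this]
  have hF0 : 0 ≤ F := Finset.sum_nonneg fun y _ => (hm0 y).le
  have := mul_le_mul_of_nonneg_right hAc hF0
  linarith

lemma enorm_sub_le_sum_grad (f : ℕ → ℝ) {y y' : ℕ} (h : y ≤ y') :
    ‖f y - f y'‖ₑ ≤ ∑ z ∈ Finset.Ico y y', ‖grad f z‖ₑ := by
  rw [enorm_sub_rev, ← Finset.sum_Ico_sub f h]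
  exact enorm_sum_le _ _

/-- The difference of the distribution functions is bounded by the two-point covariance kernel. -/
lemma HasDensity.enorm_sub_le (h : IsErgodic lam nu) {π : Measure ℕ} {f : ℕ → ℝ}
    (hf : HasDensity lam nu π f) (x : ℕ) :
    ‖π.real (Set.Iic x) - (stationary lam nu).real (Set.Iic x)‖ₑ ≤
      ∑' p : ℕ × ℕ, between p x * (ENNReal.ofReal (stationaryMass lam nu p.1) *
        ENNReal.ofReal (stationaryMass lam nu p.2) *
        ∑ z ∈ Finset.Ico p.1 p.2, ‖grad f z‖ₑ) := by
  set m := stationaryMass lam nu with hm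
  have hm0 (y : ℕ) : 0 < m y := h.mass_pos y
  have hπ : π.real (Set.Iic x) = ∑ y ∈ Finset.range (x + 1), m y * f y := by
    rw [measureReal_def, measure_Iic_eq_sum, Finset.sum_congr rfl fun y _ => hf.singleton h y,
      ← ENNReal.ofReal_sum_of_nonneg fun y _ => mul_nonneg (hm0 y).le (hf.2.1 y),
      ENNReal.toReal_ofReal (Finset.sum_nonneg fun y _ => mul_nonneg (hm0 y).le (hf.2.1 y))]
  have hμ : (stationary lam nu).real (Set.Iic x) = ∑ y ∈ Finset.range (x + 1), m y := by
    rw [measureReal_def, measure_Iic_eq_sum, Finset.sum_congr rfl fun y _ => stationary_singleton y,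
      ← ENNReal.ofReal_sum_of_nonneg fun y _ => (hm0 y).le,
      ENNReal.toReal_ofReal (Finset.sum_nonneg fun y _ => (hm0 y).le)]
  set Φ := ∑ y ∈ Finset.range (x + 1), m y * f y with hΦ
  set F := ∑ y ∈ Finset.range (x + 1), m y with hF
  have h1 (y : ℕ) := (((hasSum_ite_lt h.hasSum_mass x).mul_left (f y)).sub
    (hasSum_ite_lt (hf.hasSum h) x)).mul_left (m y)
  -- Both measures have mass `1`, so `Φ - F = Φ * (1 - F) - F * (1 - Φ)`, a sum over pairs separated
  -- by the cut after `x`.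
  have h2 : Φ - F = ∑ y ∈ Finset.range (x + 1), ∑' y', m y * (f y * (if x < y' then m y' else 0) -
      (if x < y' then m y' * f y' else 0)) := by
    rw [Finset.sum_congr rfl fun y _ => (h1 y).tsum_eq]
    have : ∑ y ∈ Finset.range (x + 1), m y * (f y * (1 - F) - (1 - Φ)) =
        Φ * (1 - F) - F * (1 - Φ) := by
      rw [hΦ, Finset.sum_mul, hF, Finset.sum_mul, ← Finset.sum_sub_distrib]
      exact Finset.sum_congr rfl fun y _ => by ring
    rw [this]
    ring
  rw [hπ, hμ, h2, tsum_between_eq]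
  refine (enorm_sum_le _ _).trans (Finset.sum_le_sum fun y hy => ?_)
  have hy : y ≤ x := by simpa [Nat.lt_succ_iff] using hy
  refine enorm_tsum_le_tsum_enorm.trans (ENNReal.tsum_le_tsum fun y' => ?_)
  split_ifs with hx
  · have : m y * (f y * m y' - m y' * f y') = m y * m y' * (f y - f y') := by ring
    rw [this, enorm_mul, enorm_mul, Real.enorm_eq_ofReal (hm0 y).le,
      Real.enorm_eq_ofReal (hm0 y').le]
    gcongr
    exact enorm_sub_le_sum_grad f (by omega)
  · simp

/-- Exchanging sums transfers the weight `u` onto the pairs and leaves the gradient outside, where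
`kernel_le` applies at each fixed `z`. -/
lemma HasDensity.tsum_enorm_sub_le (h : IsErgodic lam nu) (hu : ∀ x, 0 < u x)
    (hκ : kappa lam nu u < ⊤) {π : Measure ℕ} {f : ℕ → ℝ} (hf : HasDensity lam nu π f) :
    ∑' x, ENNReal.ofReal (u x) * ‖π.real (Set.Iic x) - (stationary lam nu).real (Set.Iic x)‖ₑ ≤
      ENNReal.ofReal (kappa lam nu u).toReal *
        ∫⁻ x, ENNReal.ofReal (lam x * u x * |grad f x|) ∂stationary lam nu := by
  set M : ℕ × ℕ → ENNReal := fun p => ENNReal.ofReal (stationaryMass lam nu p.1) *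
        ENNReal.ofReal (stationaryMass lam nu p.2) with hM
  calc _ ≤ ∑' x, ENNReal.ofReal (u x) * ∑' p : ℕ × ℕ, between p x * (M p *
        ∑ z ∈ Finset.Ico p.1 p.2, ‖grad f z‖ₑ) :=
        ENNReal.tsum_le_tsum fun x => mul_le_mul_right (hf.enorm_sub_le h x) _
    _ = ∑' p : ℕ × ℕ, M p * (∑' x, between p x * ENNReal.ofReal (u x)) *
        (∑' z, between p z * ‖grad f z‖ₑ) := by
        simp only [← ENNReal.tsum_mul_left]
        rw [ENNReal.tsum_comm]
        refine tsum_congr fun p => ?_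
        have hx (x : ℕ) : ENNReal.ofReal (u x) * (between p x *
            (M p * ∑ z ∈ Finset.Ico p.1 p.2, ‖grad f z‖ₑ)) = between p x * ENNReal.ofReal (u x) *
            (M p * ∑ z ∈ Finset.Ico p.1 p.2, ‖grad f z‖ₑ) := by ring
        simp only [hx, ENNReal.tsum_mul_right, ENNReal.tsum_mul_left, tsum_between_mul]
        ring
    _ = ∑' z, ‖grad f z‖ₑ * ∑' p : ℕ × ℕ, between p z * (M p *
        ∑ x ∈ Finset.Ico p.1 p.2, ENNReal.ofReal (u x)) := by
        simp only [← ENNReal.tsum_mul_left]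
        rw [ENNReal.tsum_comm]
        refine tsum_congr fun p => ?_
        refine tsum_congr fun z => ?_
        rw [ENNReal.tsum_mul_left, tsum_between_mul]
        ring
    _ ≤ ∑' z, ‖grad f z‖ₑ * ENNReal.ofReal ((kappa lam nu u).toReal *
        (lam z * stationaryMass lam nu z * u z)) :=
        ENNReal.tsum_le_tsum fun z => mul_le_mul_right (h.kernel_le hu hκ z) _
    _ = _ := by
        rw [lintegral_ofReal_stationary h, ← ENNReal.tsum_mul_left]
        refine tsum_congr fun z => ?_
        rw [Real.enorm_eq_ofReal_abs, ← ENNReal.ofReal_mul (abs_nonneg _),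
          ← ENNReal.ofReal_mul ENNReal.toReal_nonneg]
        congr 1
        ring

end Kernel
/-! ### The quantile coupling -/

section Coupling

open Set

/-- Quantile function of a measure on `ℕ`. -/
noncomputable def quantile (m : Measure ℕ) (t : ℝ) : ℕ := sInf {n | t ≤ m.real (Iic n)}

variable (m : Measure ℕ) [IsProbabilityMeasure m]

lemma quantile_le_iff {t : ℝ} {x : ℕ} :
    quantile m t ≤ x ↔ t ≤ m.real (Iic x) ∨ ∀ n, m.real (Iic n) < t := by
  constructor
  · intro h
    by_cases hne : ∃ n, t ≤ m.real (Iic n)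
    · exact Or.inl ((Nat.sInf_mem (s := {n | t ≤ m.real (Iic n)}) hne).trans
        (measureReal_mono (Iic_subset_Iic.2 h)))
    · push Not at hne
      exact Or.inr hne
  · rintro (h | h)
    · exact Nat.sInf_le h
    · have : {n | t ≤ m.real (Iic n)} = ∅ := by
        ext n; simpa using h n
      rw [quantile, this, Nat.sInf_empty]
      exact Nat.zero_le _

lemma quantile_le_iff_of_lt_one {t : ℝ} (ht : t < 1) {x : ℕ} :
    quantile m t ≤ x ↔ t ≤ m.real (Iic x) := by
  rw [quantile_le_iff, or_iff_left]
  intro h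
  have h1 := (ENNReal.tendsto_toReal (measure_ne_top m univ)).comp
    (tendsto_measure_Iic_atTop m)
  rw [measure_univ, ENNReal.toReal_one] at h1
  exact absurd (le_of_tendsto' h1 fun n => (h n).le) (not_le.2 ht)

lemma measurable_quantile : Measurable (quantile m) := by
  refine measurable_of_Iic fun x => ?_
  -- The intersection collects the levels that are never reached, where the infimum of the empty set
  -- is `0`.
  have : quantile m ⁻¹' Iic x = Iic (m.real (Iic x)) ∪ ⋂ n, Ioi (m.real (Iic n)) := by
    ext t; simp [quantile_le_iff]
  rw [this]
  exact measurableSet_Iic.union (MeasurableSet.iInter fun n => measurableSet_Ioi)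

lemma map_quantile : (volume.restrict (Ioo (0 : ℝ) 1)).map (quantile m) = m := by
  have : IsFiniteMeasure ((volume.restrict (Ioo (0 : ℝ) 1)).map (quantile m)) :=
    Measure.isFiniteMeasure_map _ _
  refine Measure.ext_of_Iic _ _ fun x => ?_
  rw [Measure.map_apply (measurable_quantile m) measurableSet_Iic,
    Measure.restrict_apply (measurable_quantile m measurableSet_Iic)]
  have hset : quantile m ⁻¹' Iic x ∩ Ioo (0 : ℝ) 1 = Ioc 0 (m.real (Iic x)) ∩ Iio 1 := by
    ext t
    simp only [mem_inter_iff, mem_preimage, mem_Iic, mem_Ioo, mem_Ioc, mem_Iio]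
    constructor
    · rintro ⟨h, h0, h1⟩
      exact ⟨⟨h0, (quantile_le_iff_of_lt_one m h1).1 h⟩, h1⟩
    · rintro ⟨⟨h0, h⟩, h1⟩
      exact ⟨(quantile_le_iff_of_lt_one m h1).2 h, h0, h1⟩
  have hle : m.real (Iic x) ≤ 1 := measureReal_le_one
  have hae : (Ioc 0 (m.real (Iic x)) ∩ Iio 1 : Set ℝ) =ᵐ[volume] Ioc 0 (m.real (Iic x)) := by
    have h1 : (Iio 1 : Set ℝ) =ᵐ[volume] Iic 1 := Iio_ae_eq_Iic
    have h2 : (Ioc 0 (m.real (Iic x)) ∩ Iic 1 : Set ℝ) = Ioc 0 (m.real (Iic x)) :=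
      inter_eq_left.2 fun t ht => ht.2.trans hle
    have h3 := (Filter.EventuallyEq.refl (ae volume) (Ioc 0 (m.real (Iic x)))).inter h1
    rwa [h2] at h3
  rw [hset, measure_congr hae, Real.volume_Ioc, sub_zero, ofReal_measureReal]

variable {u : ℕ → ℝ}

lemma ofReal_weightDist_le (hu : ∀ x, 0 < u x) (a b : ℕ) :
    ENNReal.ofReal (weightDist u a b) ≤
      ∑' x, ENNReal.ofReal (u x) * (if a ≤ x ↔ b ≤ x then 0 else 1) := by
  wlog h : a ≤ b generalizing a b
  · have := this b a (not_le.1 h).le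
    rw [weightDist, abs_sub_comm] at this ⊢
    simpa only [abs_sub_comm, iff_comm] using this
  rw [weightDist, abs_sub_comm, ← Finset.sum_Ico_eq_sub _ h,
    abs_of_nonneg (Finset.sum_nonneg fun i _ => (hu i).le),
    ENNReal.ofReal_sum_of_nonneg fun i _ => (hu i).le]
  refine le_trans (Finset.sum_le_sum fun x hx => ?_) (ENNReal.sum_le_tsum (Finset.Ico a b))
  rw [Finset.mem_Ico] at hx
  rw [if_neg (by simp [hx.1, hx.2]), mul_one]

/-- Drive both quantile functions by one uniform variable. The cut after `x` separates the two
values only when the variable lies between the two distribution functions at `x`. -/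
lemma wasserstein_le_tsum (hu : ∀ x, 0 < u x) (m₁ m₂ : Measure ℕ) [IsProbabilityMeasure m₁]
    [IsProbabilityMeasure m₂] :
    wasserstein (weightDist u) m₁ m₂ ≤
      ∑' x, ENNReal.ofReal (u x) * ‖m₁.real (Iic x) - m₂.real (Iic x)‖ₑ := by
  have hm : Measurable fun t => (quantile m₁ t, quantile m₂ t) :=
    (measurable_quantile m₁).prodMk (measurable_quantile m₂)
  have h1 : ((volume.restrict (Ioo (0 : ℝ) 1)).map
      fun t => (quantile m₁ t, quantile m₂ t)).map Prod.fst = m₁ := by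
    rw [Measure.map_map measurable_fst hm]; exact map_quantile m₁
  have h2 : ((volume.restrict (Ioo (0 : ℝ) 1)).map
      fun t => (quantile m₁ t, quantile m₂ t)).map Prod.snd = m₂ := by
    rw [Measure.map_map measurable_snd hm]; exact map_quantile m₂
  refine (iInf₂_le ((volume.restrict (Ioo (0 : ℝ) 1)).map
    fun t => (quantile m₁ t, quantile m₂ t)) ⟨h1, h2⟩).trans ?_
  rw [lintegral_map (measurable_of_countable _) hm]
  calc _ ≤ ∫⁻ t in Ioo (0 : ℝ) 1, ∑' x, ENNReal.ofReal (u x) *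
        (uIoc (m₂.real (Iic x)) (m₁.real (Iic x))).indicator 1 t := by
        refine setLIntegral_mono' measurableSet_Ioo fun t ht => ?_
        refine (ofReal_weightDist_le hu _ _).trans (ENNReal.tsum_le_tsum fun x => ?_)
        refine mul_le_mul_right ?_ _
        split_ifs with h
        · exact zero_le
        · rw [quantile_le_iff_of_lt_one m₁ ht.2, quantile_le_iff_of_lt_one m₂ ht.2] at h
          rw [indicator_of_mem, Pi.one_apply]
          rw [mem_uIoc]
          grind
    _ ≤ ∫⁻ t, ∑' x, ENNReal.ofReal (u x) *
        (uIoc (m₂.real (Iic x)) (m₁.real (Iic x))).indicator 1 t := setLIntegral_le_lintegral _ _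
    _ = _ := by
        rw [lintegral_tsum fun x =>
          ((measurable_one.indicator measurableSet_uIoc).const_mul _).aemeasurable]
        refine tsum_congr fun x => ?_
        rw [lintegral_const_mul _ (measurable_one.indicator measurableSet_uIoc),
          lintegral_indicator_one measurableSet_uIoc, Real.volume_uIoc, Real.enorm_eq_ofReal_abs]

end Coupling

/-! ### The weighted isoperimetric inequality -/

section Isoperimetry

variable {lam nu u : ℕ → ℝ}

lemma HasDensity.wasserstein_le (h : IsErgodic lam nu) (hu : ∀ x, 0 < u x)
    (hκ : kappa lam nu u < ⊤) {π : Measure ℕ} {f : ℕ → ℝ} (hf : HasDensity lam nu π f) :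
    wasserstein (weightDist u) π (stationary lam nu) ≤
      ENNReal.ofReal (kappa lam nu u).toReal *
        ∫⁻ x, ENNReal.ofReal (lam x * u x * |grad f x|) ∂stationary lam nu := by
  have := hf.1
  have := h.isProbabilityMeasure
  exact (wasserstein_le_tsum hu _ _).trans (hf.tsum_enorm_sub_le h hu hκ)

lemma IsErgodic.weightedIsoperimetric (h : IsErgodic lam nu) (hu : ∀ x, 0 < u x)
    (hκ : kappa lam nu u < ⊤) :
    WeightedIsoperimetric lam nu u (1 / (kappa lam nu u).toReal) := by
  have hpos := (h.exists_poisson hu hκ).1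
  refine ⟨one_div_pos.2 hpos, fun π f hf _ => ?_⟩
  refine (mul_le_mul_right (hf.wasserstein_le h hu hκ) _).trans_eq ?_
  rw [← mul_assoc, ← ENNReal.ofReal_mul (one_div_pos.2 hpos).le, one_div_mul_cancel hpos.ne',
    ENNReal.ofReal_one, one_mul]

end Isoperimetry
/-! ### The deviation function -/

section Deviation

/-- Characterises the term as the nonnegative root of `2 a t² + 2 b t = s²`, uniformly in `a = 0`
and `a > 0`; later estimates use only this. -/
lemma deviationTerm_spec {a b : ℝ} (ha : 0 ≤ a) (hb : 0 < b) (s : ℝ) :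
    0 ≤ deviationTerm a b s ∧
      2 * a * deviationTerm a b s ^ 2 + 2 * b * deviationTerm a b s = s ^ 2 := by
  rw [deviationTerm]
  split_ifs with h
  · subst h
    exact ⟨by positivity, by field_simp; ring⟩
  · have ha' : 0 < a := lt_of_le_of_ne ha (Ne.symm h)
    have h1 : 0 ≤ b ^ 2 + 2 * a * s ^ 2 := by positivity
    have h2 : b ≤ √(b ^ 2 + 2 * a * s ^ 2) := Real.le_sqrt_of_sq_le (by
      have : 0 ≤ 2 * a * s ^ 2 := by positivity
      linarith)
    refine ⟨div_nonneg (sub_nonneg.2 h2) (by positivity), ?_⟩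
    have h3 := Real.sq_sqrt h1
    field_simp
    linarith

lemma deviationTerm_le {a b s I : ℝ} (ha : 0 ≤ a) (hb : 0 < b) (hI : 0 ≤ I)
    (h : s ^ 2 ≤ 2 * a * I ^ 2 + 2 * b * I) : deviationTerm a b s ≤ I := by
  obtain ⟨h0, h1⟩ := deviationTerm_spec ha hb s
  by_contra! hlt
  have h2 := mul_le_mul_of_nonneg_left (pow_le_pow_left₀ hI hlt.le 2) ha
  have h3 := mul_lt_mul_of_pos_left hlt hb
  linarith

/-- Unlike mere strict monotonicity of each term, this scaling bound survives the supremum and keeps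
it strictly increasing. -/
lemma deviationTerm_mul_le {a b : ℝ} (ha : 0 ≤ a) (hb : 0 < b) (s : ℝ) {t : ℝ} (ht0 : 0 ≤ t)
    (ht1 : t ≤ 1) : deviationTerm a b (t * s) ≤ t * deviationTerm a b s := by
  obtain ⟨h0, h1⟩ := deviationTerm_spec ha hb s
  refine deviationTerm_le ha hb (mul_nonneg ht0 h0) ?_
  have h2 : t ^ 2 ≤ t := by nlinarith
  have h3 := mul_le_mul_of_nonneg_right h2 (mul_nonneg hb.le h0)
  rw [mul_pow, ← h1]
  linarith

/-- A modulus of continuity independent of `a` and of `b ≥ b₀`, which gives finiteness and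
continuity of the supremum. -/
lemma deviationTerm_le_add {a b b₀ : ℝ} (ha : 0 ≤ a) (hb₀ : 0 < b₀) (hb : b₀ ≤ b) (s t : ℝ) :
    deviationTerm a b t ≤ deviationTerm a b s + |t ^ 2 - s ^ 2| / (2 * b₀) := by
  have hb' : 0 < b := hb₀.trans_le hb
  obtain ⟨h0, h1⟩ := deviationTerm_spec ha hb' s
  set d := |t ^ 2 - s ^ 2| / (2 * b₀) with hd
  have hd0 : 0 ≤ d := by positivity
  have hd1 : 2 * b₀ * d = |t ^ 2 - s ^ 2| := by rw [hd]; field_simp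
  refine deviationTerm_le ha hb' (add_nonneg h0 hd0) ?_
  have h2 := le_abs_self (t ^ 2 - s ^ 2)
  have h3 := mul_le_mul_of_nonneg_right hb hd0
  have h4 : deviationTerm a b s ^ 2 ≤ (deviationTerm a b s + d) ^ 2 :=
    pow_le_pow_left₀ h0 (by linarith) 2
  have h5 := mul_le_mul_of_nonneg_left h4 ha
  linarith

lemma deviationTerm_zero {a b : ℝ} (hb : 0 < b) : deviationTerm a b 0 = 0 := by
  simp [deviationTerm, Real.sqrt_sq hb.le]

lemma deviationTerm_pos {a b s : ℝ} (ha : 0 ≤ a) (hb : 0 < b) (hs : 0 < s) :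
    0 < deviationTerm a b s := by
  obtain ⟨h0, h1⟩ := deviationTerm_spec ha hb s
  refine lt_of_le_of_ne h0 fun h => ?_
  rw [← h] at h1
  have : 0 < s ^ 2 := by positivity
  linarith

variable {κ b₀ : ℝ} {S : Set (ℝ × ℝ)} {a b : ℝ → ℝ → ℝ}

lemma bddAbove_deviationValues (hb₀ : 0 < b₀)
    (hS : ∀ ε θ, (ε, θ) ∈ S → 0 ≤ a ε θ ∧ b₀ ≤ b ε θ) (r : ℝ) :
    BddAbove (deviationValues κ S a b r) := by
  refine ⟨|(r / κ) ^ 2 - 0 ^ 2| / (2 * b₀), ?_⟩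
  rintro _ ⟨⟨ε, θ⟩, hp, rfl⟩
  obtain ⟨ha, hb⟩ := hS ε θ hp
  have := deviationTerm_le_add ha hb₀ hb 0 (r / κ)
  rwa [deviationTerm_zero (hb₀.trans_le hb), zero_add] at this

lemma le_sSup_deviationValues (hb₀ : 0 < b₀)
    (hS : ∀ ε θ, (ε, θ) ∈ S → 0 ≤ a ε θ ∧ b₀ ≤ b ε θ) (r : ℝ) {p : ℝ × ℝ} (hp : p ∈ S) :
    deviationTerm (a p.1 p.2) (b p.1 p.2) (r / κ) ≤ sSup (deviationValues κ S a b r) :=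
  le_csSup (bddAbove_deviationValues hb₀ hS r) ⟨p, hp, rfl⟩

lemma sSup_deviationValues_le_add (hb₀ : 0 < b₀) (hne : S.Nonempty)
    (hS : ∀ ε θ, (ε, θ) ∈ S → 0 ≤ a ε θ ∧ b₀ ≤ b ε θ) (r s : ℝ) :
    sSup (deviationValues κ S a b s) ≤ sSup (deviationValues κ S a b r) +
      |(s / κ) ^ 2 - (r / κ) ^ 2| / (2 * b₀) := by
  refine csSup_le (hne.image _) ?_
  rintro _ ⟨⟨ε, θ⟩, hp, rfl⟩
  obtain ⟨ha, hb⟩ := hS ε θ hp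
  exact (deviationTerm_le_add ha hb₀ hb (r / κ) (s / κ)).trans
    (add_le_add_left (le_sSup_deviationValues hb₀ hS r hp) _)

lemma continuous_sSup_deviationValues (hb₀ : 0 < b₀) (hne : S.Nonempty)
    (hS : ∀ ε θ, (ε, θ) ∈ S → 0 ≤ a ε θ ∧ b₀ ≤ b ε θ) :
    Continuous fun r => sSup (deviationValues κ S a b r) := by
  rw [continuous_iff_continuousAt]
  intro r
  rw [ContinuousAt, tendsto_iff_dist_tendsto_zero]
  have hlim : Filter.Tendsto (fun s : ℝ => |(s / κ) ^ 2 - (r / κ) ^ 2| / (2 * b₀)) (nhds r)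
      (nhds 0) := by
    have hc : Continuous fun s : ℝ => |(s / κ) ^ 2 - (r / κ) ^ 2| / (2 * b₀) := by fun_prop
    simpa using hc.tendsto r
  refine squeeze_zero (fun _ => dist_nonneg) (fun s => ?_) hlim
  rw [Real.dist_eq, abs_sub_le_iff]
  have h1 := sSup_deviationValues_le_add (κ := κ) hb₀ hne hS r s
  have h2 := sSup_deviationValues_le_add (κ := κ) hb₀ hne hS s r
  rw [abs_sub_comm] at h2
  exact ⟨by linarith, by linarith⟩

lemma sSup_deviationValues_pos (hκ : 0 < κ) (hb₀ : 0 < b₀) (hne : S.Nonempty)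
    (hS : ∀ ε θ, (ε, θ) ∈ S → 0 ≤ a ε θ ∧ b₀ ≤ b ε θ) {r : ℝ} (hr : 0 < r) :
    0 < sSup (deviationValues κ S a b r) := by
  obtain ⟨p, hp⟩ := hne
  obtain ⟨ha, hb⟩ := hS p.1 p.2 hp
  exact (deviationTerm_pos ha (hb₀.trans_le hb) (div_pos hr hκ)).trans_le
    (le_sSup_deviationValues hb₀ hS r hp)

lemma sSup_deviationValues_zero (hb₀ : 0 < b₀) (hne : S.Nonempty)
    (hS : ∀ ε θ, (ε, θ) ∈ S → 0 ≤ a ε θ ∧ b₀ ≤ b ε θ) :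
    sSup (deviationValues κ S a b 0) = 0 := by
  have : deviationValues κ S a b 0 = {0} := by
    refine Set.eq_singleton_iff_nonempty_unique_mem.2 ⟨hne.image _, ?_⟩
    rintro _ ⟨p, hp, rfl⟩
    simp only [zero_div]
    exact deviationTerm_zero (hb₀.trans_le (hS p.1 p.2 hp).2)
  rw [this, csSup_singleton]

lemma strictMonoOn_sSup_deviationValues (hκ : 0 < κ) (hb₀ : 0 < b₀) (hne : S.Nonempty)
    (hS : ∀ ε θ, (ε, θ) ∈ S → 0 ≤ a ε θ ∧ b₀ ≤ b ε θ) :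
    StrictMonoOn (fun r => sSup (deviationValues κ S a b r)) (Set.Ici 0) := by
  intro r hr s hs hrs
  have hs0 : 0 < s := lt_of_le_of_lt hr hrs
  have hpos := sSup_deviationValues_pos hκ hb₀ hne hS hs0
  have ht1 : r / s < 1 := (div_lt_one hs0).2 hrs
  have ht0 : 0 ≤ r / s := div_nonneg hr hs0.le
  refine lt_of_le_of_lt (csSup_le (hne.image _) ?_) (mul_lt_of_lt_one_left hpos ht1)
  rintro _ ⟨p, hp, rfl⟩
  obtain ⟨ha, hb⟩ := hS p.1 p.2 hp
  have h1 := deviationTerm_mul_le ha (hb₀.trans_le hb) (s / κ) ht0 ht1.le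
  have h2 : r / s * (s / κ) = r / κ := by field_simp
  rw [h2] at h1
  exact h1.trans (mul_le_mul_of_nonneg_left (le_sSup_deviationValues hb₀ hS s hp) ht0)

end Deviation

/-! ### The transportation-information inequality -/

section Information

variable {lam nu u : ℕ → ℝ}

/-- The condition at `x = 0`, where death terms vanish, supplies the lower bound on `b` uniform over
`S`. -/
lemma Lyapunov.le_const (h : IsErgodic lam nu) {ε θ a b : ℝ} (hε : 0 < ε)
    (hθ : 1 < θ) (ha : 0 ≤ a) (hL : Lyapunov lam nu u ε θ a b) : lam 0 * u 0 ^ 2 ≤ b := by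
  have h0 := hL 0
  rw [h.death_zero] at h0
  have h1 : 0 ≤ ε * (lam 0 * u 0 ^ 2) := by have := h.birth_pos 0; positivity
  have h2 : 0 ≤ a * (lam 0 * (θ - 1)) :=
    mul_nonneg ha (mul_nonneg (h.birth_pos 0).le (by linarith))
  linarith

/-- The defect is a perfect square. With detailed balance, this lets the energy of `g` absorb the
drift term of the Lyapunov condition. -/
lemma sq_mul_one_sub_inv_le {θ : ℝ} (hθ : 1 < θ) (x y : ℝ) :
    y ^ 2 * (1 - 1 / θ) ≤ (y - x) ^ 2 + x ^ 2 * (θ - 1) := by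
  have h0 : 0 < θ := by linarith
  have h1 : (y - x) ^ 2 + x ^ 2 * (θ - 1) - y ^ 2 * (1 - 1 / θ) = (θ * x - y) ^ 2 / θ := by
    field_simp
    ring
  have h2 : 0 ≤ (θ * x - y) ^ 2 / θ := by positivity
  linarith

lemma add_sq_le_weighted {ε : ℝ} (hε : 0 < ε) (x y : ℝ) :
    (x + y) ^ 2 ≤ (1 + ε) * x ^ 2 + (1 + 1 / ε) * y ^ 2 := by
  have h1 : (1 + ε) * x ^ 2 + (1 + 1 / ε) * y ^ 2 - (x + y) ^ 2 = (ε * x - y) ^ 2 / ε := by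
    field_simp
    ring
  have h2 : 0 ≤ (ε * x - y) ^ 2 / ε := by positivity
  linarith

/-- Split the square with weights `1 + ε` and `1 + 1 / ε`; detailed balance moves the `g (x+1)` part
to the death term at `x + 1`, where the Lyapunov condition applies. -/
lemma Lyapunov.sum_le (h : IsErgodic lam nu) {ε θ a b : ℝ} (hε : 0 < ε)
    (hθ : 1 < θ) (ha : 0 ≤ a) (hL : Lyapunov lam nu u ε θ a b) (g : ℕ → ℝ) (N : ℕ) :
    ∑ x ∈ Finset.range N, stationaryMass lam nu x * lam x * u x ^ 2 * (g x + g (x + 1)) ^ 2 ≤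
      a * ∑ x ∈ Finset.range N, stationaryMass lam nu x * (lam x * grad g x ^ 2) +
        b * ∑ x ∈ Finset.range (N + 1), stationaryMass lam nu x * g x ^ 2 := by
  set m := stationaryMass lam nu with hm
  have hm0 (x : ℕ) : 0 < m x := h.mass_pos x
  have hLm (x : ℕ) : (1 + ε) * (m x * lam x * u x ^ 2 * g x ^ 2) +
      ((1 + 1 / ε) * (nu x * m x * u (x - 1) ^ 2 * g x ^ 2) -
        a * (nu x * m x * g x ^ 2 * (1 - 1 / θ))) ≤
      b * (m x * g x ^ 2) - a * (m x * lam x * (g x ^ 2 * (θ - 1))) := by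
    have := mul_le_mul_of_nonneg_left (hL x) (mul_nonneg (hm0 x).le (sq_nonneg (g x)))
    linarith
  -- The last summand is the boundary term left at `N` by the shift. The Lyapunov condition at `N`
  -- finally absorbs it, whence `N + 1` in the last sum.
  have hclaim (N : ℕ) :
      ∑ x ∈ Finset.range N, m x * lam x * u x ^ 2 * (g x + g (x + 1)) ^ 2 ≤
      a * ∑ x ∈ Finset.range N, m x * (lam x * grad g x ^ 2) +
        b * ∑ x ∈ Finset.range N, m x * g x ^ 2 +
        ((1 + 1 / ε) * (nu N * m N * u (N - 1) ^ 2 * g N ^ 2) -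
          a * (nu N * m N * g N ^ 2 * (1 - 1 / θ))) := by
    induction N with
    | zero => simp [h.death_zero]
    | succ N ih =>
      rw [Finset.sum_range_succ, Finset.sum_range_succ, Finset.sum_range_succ, h.balance N,
        Nat.add_sub_cancel, grad]
      have h1 := hLm N
      have hml : 0 ≤ m N * lam N := (mul_pos (hm0 N) (h.birth_pos N)).le
      have h2 := mul_le_mul_of_nonneg_left (mul_le_mul_of_nonneg_left
        (sq_mul_one_sub_inv_le hθ (g N) (g (N + 1))) hml) ha
      have h3 := mul_le_mul_of_nonneg_left (add_sq_le_weighted hε (g N) (g (N + 1)))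
        (mul_nonneg hml (sq_nonneg (u N)))
      linarith
  refine (hclaim N).trans ?_
  rw [Finset.sum_range_succ _ N]
  have h1 := hLm N
  have h2 : 0 ≤ (1 + ε) * (m N * lam N * u N ^ 2 * g N ^ 2) := by
    have := h.birth_pos N; have := hm0 N; positivity
  have h3 : 0 ≤ a * (m N * lam N * (g N ^ 2 * (θ - 1))) :=
    mul_nonneg ha (mul_nonneg (mul_pos (hm0 N) (h.birth_pos N)).le
      (mul_nonneg (sq_nonneg _) (by linarith)))
  linarith

lemma HasDensity.lintegral_grad_le (h : IsErgodic lam nu) (hu : ∀ x, 0 < u x) {ε θ a b : ℝ}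
    (hε : 0 < ε) (hθ : 1 < θ) (ha : 0 ≤ a) (hb : 0 < b) (hL : Lyapunov lam nu u ε θ a b)
    {π : Measure ℕ} {f : ℕ → ℝ} (hf : HasDensity lam nu π f)
    (hE : energy lam nu (fun x => √(f x)) < ⊤) :
    ∫⁻ x, ENNReal.ofReal (lam x * u x * |grad f x|) ∂stationary lam nu ≤
      ENNReal.ofReal √((energy lam nu (fun x => √(f x))).toReal *
        (a * (energy lam nu (fun x => √(f x))).toReal + b)) := by
  set m := stationaryMass lam nu with hm
  have hm0 (x : ℕ) : 0 < m x := h.mass_pos x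
  set g : ℕ → ℝ := fun x => √(f x) with hg
  have hg0 (x : ℕ) : 0 ≤ g x := Real.sqrt_nonneg _
  have hgf (x : ℕ) : g x ^ 2 = f x := Real.sq_sqrt (hf.2.1 x)
  set I := (energy lam nu g).toReal with hI
  have hI0 : 0 ≤ I := ENNReal.toReal_nonneg
  have hIN (N : ℕ) : ∑ x ∈ Finset.range N, m x * (lam x * grad g x ^ 2) ≤ I := by
    have hnn (x : ℕ) : 0 ≤ m x * (lam x * grad g x ^ 2) :=
      mul_nonneg (hm0 x).le (mul_nonneg (h.birth_pos x).le (sq_nonneg _))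
    rw [hI, ← ENNReal.ofReal_le_iff_le_toReal hE.ne,
      ENNReal.ofReal_sum_of_nonneg fun x _ => hnn x, energy, lintegral_ofReal_stationary h]
    exact ENNReal.sum_le_tsum _
  have hfN (N : ℕ) : ∑ x ∈ Finset.range N, m x * g x ^ 2 ≤ 1 := by
    simp only [hgf]
    exact sum_le_hasSum _ (fun x _ => mul_nonneg (hm0 x).le (hf.2.1 x)) (hf.hasSum h)
  rw [lintegral_ofReal_stationary h]
  refine ENNReal.tsum_le_of_sum_range_le fun N => ?_
  rw [← ENNReal.ofReal_sum_of_nonneg fun x _ => mul_nonneg (hm0 x).le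
    (mul_nonneg (mul_pos (h.birth_pos x) (hu x)).le (abs_nonneg _))]
  refine ENNReal.ofReal_le_ofReal (Real.le_sqrt_of_sq_le ?_)
  -- Factored for Cauchy-Schwarz: the first factor yields the energy, the second the sum in
  -- `Lyapunov.sum_le`.
  have hterm (x : ℕ) : m x * (lam x * u x * |grad f x|) =
      (√(m x * lam x) * |grad g x|) * (√(m x * lam x) * (u x * (g x + g (x + 1)))) := by
    have h1 : grad f x = grad g x * (g x + g (x + 1)) := by
      rw [grad, grad, ← hgf, ← hgf]; ring
    have h2 := Real.mul_self_sqrt (mul_pos (hm0 x) (h.birth_pos x)).le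
    rw [h1, abs_mul, abs_of_nonneg (add_nonneg (hg0 x) (hg0 (x + 1)))]
    calc _ = (m x * lam x) * (|grad g x| * (u x * (g x + g (x + 1)))) := by ring
      _ = (√(m x * lam x) * √(m x * lam x)) * (|grad g x| * (u x * (g x + g (x + 1)))) := by
        rw [h2]
      _ = _ := by ring
  rw [Finset.sum_congr rfl fun x _ => hterm x]
  refine (Finset.sum_mul_sq_le_sq_mul_sq _ _ _).trans ?_
  have hs (x : ℕ) : √(m x * lam x) ^ 2 = m x * lam x :=
    Real.sq_sqrt (mul_pos (hm0 x) (h.birth_pos x)).le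
  have hA : ∑ x ∈ Finset.range N, (√(m x * lam x) * |grad g x|) ^ 2 ≤ I := by
    refine le_of_eq_of_le (Finset.sum_congr rfl fun x _ => ?_) (hIN N)
    rw [mul_pow, hs, sq_abs, mul_assoc]
  have hB : ∑ x ∈ Finset.range N, (√(m x * lam x) * (u x * (g x + g (x + 1)))) ^ 2 ≤
      a * I + b := by
    refine le_of_eq_of_le (Finset.sum_congr rfl fun x _ => ?_)
      ((hL.sum_le h hε hθ ha g N).trans ?_)
    · rw [mul_pow, hs, mul_pow, ← mul_assoc]
    · have h1 := mul_le_mul_of_nonneg_left (hIN N) ha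
      have h2 := mul_le_mul_of_nonneg_left (hfN (N + 1)) hb.le
      rw [← hm]
      linarith
  exact mul_le_mul hA hB (Finset.sum_nonneg fun x _ => sq_nonneg _) hI0

lemma extendTop_le_information (h : IsErgodic lam nu) (hu : ∀ x, 0 < u x)
    (hκ : kappa lam nu u < ⊤) {S : Set (ℝ × ℝ)} {a b : ℝ → ℝ → ℝ} (hne : S.Nonempty)
    (hS : ∀ ε θ, (ε, θ) ∈ S → 0 < ε ∧ 1 < θ ∧ 0 ≤ a ε θ ∧ 0 < b ε θ ∧
      Lyapunov lam nu u ε θ (a ε θ) (b ε θ))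
    {π : Measure ℕ} {f : ℕ → ℝ} (hf : HasDensity lam nu π f) :
    extendTop (fun r => sSup (deviationValues (kappa lam nu u).toReal S a b r))
      (wasserstein (weightDist u) π (stationary lam nu)) ≤ information lam nu f := by
  rw [information]
  split_ifs with hD
  swap
  · exact le_top
  have hpos := (h.exists_poisson hu hκ).1
  set κ := (kappa lam nu u).toReal with hκdef
  set I := (energy lam nu fun x => √(f x)).toReal with hI
  set W := wasserstein (weightDist u) π (stationary lam nu) with hW
  have hI0 : 0 ≤ I := ENNReal.toReal_nonneg
  have hWle (p : ℝ × ℝ) (hp : p ∈ S) :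
      W ≤ ENNReal.ofReal (κ * √(I * (a p.1 p.2 * I + b p.1 p.2))) := by
    obtain ⟨hε, hθ, ha, hb, hL⟩ := hS p.1 p.2 hp
    rw [ENNReal.ofReal_mul hpos.le]
    exact (hf.wasserstein_le h hu hκ).trans
      (mul_le_mul_right (hf.lintegral_grad_le h hu hε hθ ha hb hL hD.2) _)
  have hWtop : W ≠ ⊤ := by
    obtain ⟨p, hp⟩ := hne
    exact ((hWle p hp).trans_lt ENNReal.ofReal_lt_top).ne
  rw [extendTop, if_neg hWtop, ← ENNReal.ofReal_toReal hD.2.ne]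
  refine ENNReal.ofReal_le_ofReal (csSup_le (hne.image _) ?_)
  rintro _ ⟨p, hp, rfl⟩
  obtain ⟨hε, hθ, ha, hb, hL⟩ := hS p.1 p.2 hp
  -- It remains to show `(W/κ)² ≤ 2aI² + 2bI`; the bound `hWle` gives half of the right side.
  refine deviationTerm_le ha hb hI0 ?_
  have hQ : 0 ≤ I * (a p.1 p.2 * I + b p.1 p.2) := by positivity
  have h1 : W.toReal / κ ≤ √(I * (a p.1 p.2 * I + b p.1 p.2)) := by
    rw [div_le_iff₀' hpos]
    exact ENNReal.toReal_le_of_le_ofReal (by positivity) (hWle p hp)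
  have h2 := pow_le_pow_left₀ (div_nonneg ENNReal.toReal_nonneg hpos.le) h1 2
  rw [Real.sq_sqrt hQ] at h2
  linarith

end Information
end BirthDeath

theorem mainTheorem6 (lam nu u : ℕ → ℝ) (hrates : BirthDeath.IsErgodic lam nu)
    (hu : ∀ x, 0 < u x) (hκ : BirthDeath.kappa lam nu u < ⊤) :
    BirthDeath.WeightedIsoperimetric lam nu u (1 / (BirthDeath.kappa lam nu u).toReal) ∧
    ∀ (S : Set (ℝ × ℝ)) (a b : ℝ → ℝ → ℝ), S.Nonempty →
      (∀ ε θ, (ε, θ) ∈ S → 0 < ε ∧ 1 < θ ∧ 0 ≤ a ε θ ∧ 0 < b ε θ ∧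
        BirthDeath.Lyapunov lam nu u ε θ (a ε θ) (b ε θ)) →
      (∀ r, BddAbove
        (BirthDeath.deviationValues (BirthDeath.kappa lam nu u).toReal S a b r)) ∧
      BirthDeath.TransportationInformation lam nu u
        (fun r => sSup
          (BirthDeath.deviationValues (BirthDeath.kappa lam nu u).toReal S a b r)) := by
  refine ⟨hrates.weightedIsoperimetric hu hκ, fun S a b hne hS => ?_⟩
  have hpos := (hrates.exists_poisson hu hκ).1
  have hb₀ : 0 < lam 0 * u 0 ^ 2 := mul_pos (hrates.birth_pos 0) (pow_pos (hu 0) 2)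
  have hS' (ε θ : ℝ) (hp : (ε, θ) ∈ S) : 0 ≤ a ε θ ∧ lam 0 * u 0 ^ 2 ≤ b ε θ := by
    obtain ⟨hε, hθ, ha, -, hL⟩ := hS ε θ hp
    exact ⟨ha, hL.le_const hrates hε hθ ha⟩
  exact ⟨BirthDeath.bddAbove_deviationValues hb₀ hS',
    ⟨(BirthDeath.continuous_sSup_deviationValues hb₀ hne hS').continuousOn,
      BirthDeath.strictMonoOn_sSup_deviationValues hpos hb₀ hne hS',
      BirthDeath.sSup_deviationValues_zero hb₀ hne hS',
      fun r hr => BirthDeath.sSup_deviationValues_pos hpos hb₀ hne hS' hr⟩,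
    fun π f hf => BirthDeath.extendTop_le_information hrates hu hκ hne hS hf⟩
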